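/- Let $k$ be a perfect field of characteristic $p>0$. "Smooth $k$-scheme" means a scheme that is smooth and of finite type over $k$, and morphisms between smooth $k$-schemes are morphisms over $k$. For a simplicial scheme $Y_\bullet$ over a scheme $X$, let $\operatorname{sk}_n^X$ and $\operatorname{cosk}_n^X$ denote $n$-truncation and $n$-coskeleton of simplicial $X$-schemes, with $\operatorname{cosk}_{-1}^X$ the constant simplicial scheme $X$ (so that the target of $(*)$ for $n=-1$ is $X$). Definitions. * $Y_\bullet\to X$ is an étale hypercovering if every $Y_n$ is separated and of finite type over $X$ and the canonical morphism $$(*)\qquad Y_{n+1}\to \operatorname{cosk}_n^X(\operatorname{sk}_n^X(Y_\bullet))_{n+1}$$ is étale and surjective for every $n\ge -1$. * A refinement of an étale hypercovering $Y_\bullet\to X$ is an étale hypercovering $V_\bullet\to X$ together with a morphism $V_\bullet\to Y_\bullet$ of simplicial $X$-schemes such that $$V_{n+1}\to \operatorname{cosk}_n^X(\operatorname{sk}_n^X(V_\bullet))_{n+1}\times_{\operatorname{cosk}_n^X(\operatorname{sk}_n^X(Y_\bullet))_{n+1}}Y_{n+1}$$ is étale and surjective for every $n\ge -1$. * $Y_\bullet$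 is split if there are subobjects $N_m\subset Y_m$, $m\ge 0$, such that for every $n\ge 0$ the natural morphism $\bigsqcup_{\phi:[n]\twoheadrightarrow[m]}N_m\to Y_n$, given on the summand of $\phi$ by $N_m\subset Y_m\xrightarrow{Y_\bullet(\phi)}Y_n$, is an isomorphism. * A $k$-scheme is affine standard smooth if it is isomorphic to $\operatorname{Spec}A$ with $A=k[X_1,\dots,X_n]/(f_1,\dots,f_m)$, where $m\le n$ and $\det(\partial f_i/\partial X_j)_{1\le i,j\le m}$ is a unit in $A$. * A special hypercovering of a smooth $k$-scheme $X$ is a split étale hypercovering $Y_\bullet\to X$ such that each $Y_n$ is, as an $X$-scheme, isomorphic to the disjoint union of a finite family of affine standard smooth open subschemes of $X$ which cover $X$. Proposition. 1. Every smooth $k$-scheme $X$ has a special hypercovering. 2. If $Y_\bullet$ and $Y'_\bullet$ are special hypercoverings of a smooth $k$-scheme $X$, then there is a special hypercovering $Y''_\bullet$ of $X$ with morphisms $Y''_\bullet\to Y_\bullet$ and $Y''_\bullet\to Y'_\bullet$ over $X$ through which it is a refinement both of $Y_\bullet$ and of $Y'_\bullet$. 3. For every morphism $f:X\to X'$ of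 smooth $k$-schemes there are special hypercoverings $Y_\bullet\to X$ and $Y'_\bullet\to X'$ and a morphism of simplicial schemes $Y_\bullet\to Y'_\bullet$ that makes the square $$\begin{array}{ccc}Y_\bullet&\to&Y'_\bullet\\ \downarrow&&\downarrow\\ X&\xrightarrow{\,f\,}&X'\end{array}$$ commute. -/

import Mathlib

open CategoryTheory CategoryTheory.Limits AlgebraicGeometry Opposite Simplicial

universe u

namespace SpecialHypercovering

section Coskeleta

instance finite_structuredArrow (n : ℕ) (d : SimplexCategoryᵒᵖ) :
    Finite (StructuredArrow d (SimplexCategory.Truncated.inclusion n).op) := by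
  have : Finite (SimplexCategory.Truncated n) :=
    Finite.of_injective (β := Fin (n + 1))
      (fun x => ⟨x.obj.len, Nat.lt_succ_of_le x.property⟩)
      (fun x y h => ObjectProperty.FullSubcategory.ext
        (SimplexCategory.ext (congrArg Fin.val h)))
  have : Finite (SimplexCategory.Truncated n)ᵒᵖ := Finite.of_equiv _ equivToOpposite
  have h (e : (SimplexCategory.Truncated n)ᵒᵖ) :
      Finite (d ⟶ (SimplexCategory.Truncated.inclusion n).op.obj e) :=
    Finite.of_injective Quiver.Hom.unop Quiver.Hom.unop_inj
  refine Finite.of_surjective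
    (fun p : (Σ e : (SimplexCategory.Truncated n)ᵒᵖ,
      (d ⟶ (SimplexCategory.Truncated.inclusion n).op.obj e)) => StructuredArrow.mk p.2)
    (fun x => ⟨⟨x.right, x.hom⟩, (StructuredArrow.eq_mk x).symm⟩)

instance finite_structuredArrow_hom (n : ℕ) (d : SimplexCategoryᵒᵖ)
    (x y : StructuredArrow d (SimplexCategory.Truncated.inclusion n).op) : Finite (x ⟶ y) := by
  have : Finite (x.right.unop.obj ⟶ y.right.unop.obj) := inferInstance
  refine Finite.of_injective
    (fun f => ((SimplexCategory.Truncated.inclusion n).op.map f.right).unop)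
    (fun f g h => ?_)
  exact StructuredArrow.ext _ _
    ((SimplexCategory.Truncated.inclusion n).op.map_injective (Quiver.Hom.unop_inj h))

/-- In a category with finite limits all coskeleta exist. -/
instance hasRightKanExtension_inclusion {C : Type*} [Category* C] [HasFiniteLimits C] (n : ℕ)
    (F : (SimplexCategory.Truncated n)ᵒᵖ ⥤ C) :
    (SimplexCategory.Truncated.inclusion n).op.HasRightKanExtension F := by
  have : (SimplexCategory.Truncated.inclusion n).op.HasPointwiseRightKanExtension F := fun d => by
    let _ : FinCategory (StructuredArrow d (SimplexCategory.Truncated.inclusion n).op) :=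
      { fintypeObj := Fintype.ofFinite _
        fintypeHom := fun _ _ => Fintype.ofFinite _ }
    have : HasLimitsOfShape
        (StructuredArrow d (SimplexCategory.Truncated.inclusion n).op) C :=
      HasFiniteLimits.out _
    exact inferInstanceAs (HasLimit _)
  infer_instance

end Coskeleta

section Coskeleta

variable {C : Type*} [Category* C] [HasFiniteLimits C]

/-- The object `cosk_n(sk_n(Y))_{n+1}`. For `C = Over X` the coskeleton is the one relative
to `X`. -/
noncomputable def coskSucc (n : ℕ) (Y : SimplicialObject C) : C :=
  ((SimplicialObject.cosk n).obj Y) _⦋n + 1⦌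

/-- The map `cosk_n(sk_n(V))_{n+1} ⟶ cosk_n(sk_n(Y))_{n+1}` induced by `g : V ⟶ Y`. -/
noncomputable def coskSuccMap (n : ℕ) {V Y : SimplicialObject C} (g : V ⟶ Y) :
    coskSucc n V ⟶ coskSucc n Y :=
  ((SimplicialObject.cosk n).map g).app (op ⦋n + 1⦌)

/-- The canonical map `Y_{n+1} ⟶ cosk_n(sk_n(Y))_{n+1}`. -/
noncomputable def toCoskSucc (n : ℕ) (Y : SimplicialObject C) : Y _⦋n + 1⦌ ⟶ coskSucc n Y :=
  ((SimplicialObject.coskAdj n).unit.app Y).app (op ⦋n + 1⦌)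

lemma toCoskSucc_naturality (n : ℕ) {V Y : SimplicialObject C} (g : V ⟶ Y) :
    toCoskSucc n V ≫ coskSuccMap n g = g.app (op ⦋n + 1⦌) ≫ toCoskSucc n Y :=
  (NatTrans.congr_app ((SimplicialObject.coskAdj (C := C) n).unit.naturality g)
    (op ⦋n + 1⦌)).symm

/-- The map `V_{n+1} ⟶ cosk_n(sk_n(V))_{n+1} ×_{cosk_n(sk_n(Y))_{n+1}} Y_{n+1}` induced by
`g : V ⟶ Y`. -/
noncomputable def relativeToCoskSucc (n : ℕ) {V Y : SimplicialObject C} (g : V ⟶ Y) :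
    V _⦋n + 1⦌ ⟶ pullback (coskSuccMap n g) (toCoskSucc n Y) :=
  pullback.lift (toCoskSucc n V) (g.app (op ⦋n + 1⦌)) (toCoskSucc_naturality n g)

end Coskeleta

/-- A morphism of schemes is étale surjective if it is étale and surjective. -/
def EtaleSurjective {Y Z : Scheme.{u}} (f : Y ⟶ Z) : Prop :=
  Etale f ∧ Surjective f

/-- `Y_• ⟶ X` is an étale hypercovering: every `Y_n` is separated of finite type over `X`, and
`Y_{n+1} ⟶ cosk_n^X(sk_n^X(Y_•))_{n+1}` is étale surjective for all `n ≥ -1`. As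
`cosk_{-1}^X` is constant with value `X`, the case `n = -1` is the condition on `Y_0 ⟶ X`. -/
structure IsEtaleHypercovering {X : Scheme.{u}} (Y : SimplicialObject (Over X)) : Prop where
  isSeparated (n : ℕ) : IsSeparated (Y _⦋n⦌).hom
  locallyOfFiniteType (n : ℕ) : LocallyOfFiniteType (Y _⦋n⦌).hom
  quasiCompact (n : ℕ) : QuasiCompact (Y _⦋n⦌).hom
  zero : EtaleSurjective (Y _⦋0⦌).hom
  succ (n : ℕ) : EtaleSurjective (toCoskSucc n Y).left

/-- The étale hypercovering `V_•` refines the étale hypercovering `Y_•` by means of the morphism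
`g` over `X`: the maps
`V_{n+1} ⟶ cosk_n^X(sk_n^X(V_•))_{n+1} ×_{cosk_n^X(sk_n^X(Y_•))_{n+1}} Y_{n+1}`
are étale surjective for all `n ≥ -1`. For `n = -1` the target is `X ×_X Y_0 = Y_0`. -/
structure IsRefinement {X : Scheme.{u}} {V Y : SimplicialObject (Over X)} (g : V ⟶ Y) : Prop where
  source : IsEtaleHypercovering V
  target : IsEtaleHypercovering Y
  zero : EtaleSurjective (g.app (op ⦋0⦌)).left
  succ (n : ℕ) : EtaleSurjective (relativeToCoskSucc n g).left

/-- `Y_•` is split: there are subobjects `N_m` of `Y_m` such that for every `n` the maps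
`N_m ⟶ Y_m ⟶ Y_n`, for `φ : [n] ↠ [m]`, exhibit `Y_n` as the disjoint union over all `φ`
of the `N_m`. -/
def IsSplit {X : Scheme.{u}} (Y : SimplicialObject (Over X)) : Prop :=
  ∃ s : SimplicialObject.Splitting Y, ∀ m : ℕ, Mono (s.ι m)

/-- The `k`-scheme `U` is affine standard smooth: `U = Spec A` with `A` standard smooth
over `k`, that is `A ≅ k[X₁, …, Xₙ]/(f₁, …, fₘ)` with `m ≤ n` and
`det (∂fᵢ/∂Xⱼ)_{1 ≤ i, j ≤ m}` a unit in `A`. -/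
def IsAffineStandardSmooth {k : Type u} [Field k] {U : Scheme.{u}}
    (s : U ⟶ Spec (CommRingCat.of k)) : Prop :=
  IsAffine U ∧
    ((Scheme.ΓSpecIso (CommRingCat.of k)).inv ≫ s.appTop).hom.IsStandardSmooth

/-- `T` is, as an `X`-scheme, the disjoint union of finitely many affine standard smooth open
subschemes of `X` which cover `X`. Here `X` is regarded as a `k`-scheme through `s`. -/
def IsDisjointUnionOfStandardSmoothCovering {k : Type u} [Field k] {X : Scheme.{u}}
    (s : X ⟶ Spec (CommRingCat.of k)) (T : Over X) : Prop :=
  ∃ (r : ℕ) (U : Fin r → X.Opens),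
    (∀ i, IsAffineStandardSmooth ((U i).ι ≫ s)) ∧
    (⨆ i, U i) = ⊤ ∧
    Nonempty (T ≅ Over.mk (Sigma.desc fun i => (U i).ι))

/-- `Y_• ⟶ X` is a special hypercovering of the `k`-scheme `X` (with structure map `s`). -/
structure IsSpecialHypercovering {k : Type u} [Field k] {X : Scheme.{u}}
    (s : X ⟶ Spec (CommRingCat.of k)) (Y : SimplicialObject (Over X)) : Prop where
  isEtaleHypercovering : IsEtaleHypercovering Y
  isSplit : IsSplit Y
  level (n : ℕ) : IsDisjointUnionOfStandardSmoothCovering s (Y _⦋n⦌)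

/-- The simplicial `X'`-scheme with the same underlying simplicial scheme as the simplicial
`X`-scheme `Y_•`, where `X'` receives a morphism `f` from `X`. A morphism from it to a simplicial
`X'`-scheme `Y'_•` is a morphism of simplicial schemes `Y_• ⟶ Y'_•` which lies over `f`. -/
def pushforward {X X' : Scheme.{u}} (f : X ⟶ X') (Y : SimplicialObject (Over X)) :
    SimplicialObject (Over X') :=
  Y ⋙ Over.map f

end SpecialHypercovering

open SpecialHypercovering

/-!
The hypercoverings are produced from combinatorial data. A system of open subsets of `X`
(`OpenSystem`) is a simplicial set together with an open subset `U σ` for every simplex `σ`, such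
that `U σ ⊆ U τ` whenever `τ` is obtained from `σ` by a simplicial operator. Its realization is
the simplicial scheme over `X` with `n`-th level the disjoint union of the `U σ`, for `σ` of
dimension `n`. A degenerate simplex has the same open subset as the simplex from which it comes,
so the nondegenerate simplices split the realization (`OpenSystem.splitting`). The `L`-valued
points of the realization over a point of `X` with values in a field `L` are the simplices whose
open subset contains the image `x` of this point; they form the stalk of the system at `x`.

A morphism between étale `X`-schemes is étale, and it is surjective if it is surjective on
field-valued points. As coskeleta are finite limits, the levels of the coskeleton of an étale
simplicial `X`-scheme are étale over `X`, and the points of the coskeleton are the matching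
families of points. Hence the realization is an étale hypercovering as soon as all stalks are
trivial fibrations over the point (`OpenSystem.IsHypercovering`,
`OpenSystem.isSpecialHypercovering_realization`), and a morphism of systems gives a refinement as
soon as it is a trivial fibration on all stalks (`Hom.IsLocalTrivialFibration`,
`isRefinement_of_points`).

The main construction is `OpenSystem.refine`. Let `P 0 ⊆ P 1 ⊆ ⋯` be families of open subsets such
that every intersection of members of `P n` with an open subset of an `n`-simplex of `F` is
covered by the members of `P (n + 1)` which it contains. An `n`-simplex of the refinement is an
`n`-simplex `σ` of `F` together with a member of `P (m + 1)` for every `m`-dimensional face of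
`σ`, contained in the open subset of this face and decreasing as the face grows. Then the projection to `F` is a local trivial fibration: a
matching family prescribes the open subsets of all proper faces, and it is completed by a member
of the next family which is contained in all of them. On a smooth `k`-scheme, which is
noetherian, one can take finite families of affine standard smooth open subsets
(`OpenSystem.exists_standardSmooth_refinement`).

* A special hypercovering is obtained by refining the system with one simplex in each degree and
  the open subset `X`.
* Every special hypercovering `Y` is the realization of a system, whose simplices are the
  connected components of the levels and whose open subsets are their images in `X`
  (`componentSystemIso`). That this system is a hypercovering is seen on points, which lift after
  a field extension (`OpenSystem.isHypercovering_of_iso`). A common refinement of two special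
  hypercoverings comes from a refinement of the product of their systems.
* For `f : X ⟶ X'`, the pull-back along `f` of a system on `X'` is a system on `X`; a refinement
  of it maps to the given system over `f` (`OpenSystem.Hom.realizationOver`).
-/

namespace SpecialHypercovering

/-! ### Trivial fibrations of simplicial sets -/

/-- A compatible family of simplices `a_θ` of `A`, one for each map `θ : Δ ⟶ ⦋n + 1⦌` with
`Δ` of dimension at most `n`: an `(n + 1)`-simplex of the `n`-coskeleton of `A`. -/
structure Matching (A : SSet.{u}) (n : ℕ) where
  /-- the simplex attached to `θ` -/
  val : ∀ {Δ : SimplexCategory} (_ : Δ.len ≤ n) (_ : Δ ⟶ ⦋n + 1⦌), A.obj (op Δ)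
  comp : ∀ {Δ Δ' : SimplexCategory} (h : Δ.len ≤ n) (h' : Δ'.len ≤ n) (ψ : Δ' ⟶ Δ)
    (θ : Δ ⟶ ⦋n + 1⦌), A.map ψ.op (val h θ) = val h' (ψ ≫ θ)

/-- The image of a matching family under a map of simplicial sets. -/
def Matching.map {A B : SSet.{u}} (φ : A ⟶ B) {n : ℕ} (a : Matching A n) : Matching B n where
  val h θ := φ.app _ (a.val h θ)
  comp h h' ψ θ := by
    rw [← a.comp h h' ψ θ]
    exact (NatTrans.naturality_apply φ ψ.op (a.val h θ)).symm

/-- A map `φ : A ⟶ B` of simplicial sets is a trivial fibration if `A_{n+1}` surjects onto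
`cosk_n(A)_{n+1} ×_{cosk_n(B)_{n+1}} B_{n+1}` for all `n ≥ -1`. -/
structure IsTrivialFibration {A B : SSet.{u}} (φ : A ⟶ B) : Prop where
  zero : Function.Surjective (φ.app (op ⦋0⦌))
  succ {n : ℕ} (a : Matching A n) (b : B.obj (op ⦋n + 1⦌))
    (h : ∀ {Δ : SimplexCategory} (hΔ : Δ.len ≤ n) (θ : Δ ⟶ ⦋n + 1⦌),
      B.map θ.op b = φ.app _ (a.val hΔ θ)) :
    ∃ c : A.obj (op ⦋n + 1⦌), (∀ {Δ : SimplexCategory} (hΔ : Δ.len ≤ n) (θ : Δ ⟶ ⦋n + 1⦌),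
      A.map θ.op c = a.val hΔ θ) ∧ φ.app _ c = b

lemma IsTrivialFibration.comp {A B C : SSet.{u}} {φ : A ⟶ B} {ψ : B ⟶ C}
    (hφ : IsTrivialFibration φ) (hψ : IsTrivialFibration ψ) : IsTrivialFibration (φ ≫ ψ) where
  zero := by
    intro c
    obtain ⟨b, rfl⟩ := hψ.zero c
    obtain ⟨a, rfl⟩ := hφ.zero b
    exact ⟨a, rfl⟩
  succ a c h := by
    obtain ⟨b, hb, rfl⟩ := hψ.succ (a.map φ) c h
    obtain ⟨a', ha', rfl⟩ := hφ.succ a b hb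
    exact ⟨a', ha', rfl⟩

lemma IsTrivialFibration.of_isIso {A B : SSet.{u}} (φ : A ⟶ B) [IsIso φ] :
    IsTrivialFibration φ where
  zero b := ⟨(inv φ).app _ b, by
    simp [← ConcreteCategory.comp_apply]⟩
  succ {n} a b h := by
    refine ⟨(inv φ).app _ b, fun {Δ} hΔ θ => ?_, by
      simp [← ConcreteCategory.comp_apply]⟩
    rw [← NatTrans.naturality_apply, h hΔ]
    simp [← ConcreteCategory.comp_apply]

/-- The simplicial set with one simplex in each dimension. -/
abbrev pointSSet : SSet.{u} := (Functor.const _).obj PUnit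

/-- The map to the point. -/
abbrev toPoint (A : SSet.{u}) : A ⟶ pointSSet where
  app _ := ↾fun _ => PUnit.unit

/-! ### Simplicial systems of open subsets -/

section

open TopologicalSpace

/-- A simplicial system of open subsets of `X`: a simplicial set together with an open subset
`U σ` for every simplex `σ`, such that `U σ` is contained in `U τ` for all `τ` obtained from `σ`
by a simplicial operator. -/
structure OpenSystem (X : Type u) [TopologicalSpace X] where
  /-- the simplicial set of indices -/
  K : SSet.{u}
  /-- the open subset attached to a simplex -/
  U : ∀ {Δ : SimplexCategoryᵒᵖ}, K.obj Δ → Opens X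
  le : ∀ {Δ Δ' : SimplexCategoryᵒᵖ} (θ : Δ ⟶ Δ') (σ : K.obj Δ), U σ ≤ U (K.map θ σ)

namespace OpenSystem

variable {X : Type u} [TopologicalSpace X]

/-- A morphism of systems of open subsets is a map of simplicial sets which is compatible with
the inclusions of the open subsets. -/
structure Hom (F G : OpenSystem X) where
  /-- the map of simplicial sets -/
  φ : F.K ⟶ G.K
  le : ∀ {Δ : SimplexCategoryᵒᵖ} (σ : F.K.obj Δ), F.U σ ≤ G.U (φ.app Δ σ)

/-- Degenerate simplices carry the same open subset as the simplex they come from. -/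
lemma U_map_of_isSplitEpi (F : OpenSystem X) {Δ Δ' : SimplexCategory} (e : Δ' ⟶ Δ) [IsSplitEpi e]
    (σ : F.K.obj (op Δ)) : F.U (F.K.map e.op σ) = F.U σ := by
  refine le_antisymm ?_ (F.le _ _)
  refine (F.le (section_ e).op _).trans (le_of_eq ?_)
  rw [← ConcreteCategory.comp_apply, ← Functor.map_comp, ← op_comp, IsSplitEpi.id]
  simp

/-- The simplicial set of those simplices whose open subset contains the point `x`. -/
def stalk (F : OpenSystem X) (x : X) : SSet.{u} where
  obj Δ := {σ : F.K.obj Δ // x ∈ F.U σ}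
  map θ := ↾fun σ => ⟨F.K.map θ σ.1, F.le θ σ.1 σ.2⟩
  map_id Δ := ConcreteCategory.hom_ext _ _ fun σ =>
    Subtype.ext (ConcreteCategory.congr_hom (F.K.map_id Δ) σ.1)
  map_comp f g := ConcreteCategory.hom_ext _ _ fun σ =>
    Subtype.ext (ConcreteCategory.congr_hom (F.K.map_comp f g) σ.1)

/-- The map induced on stalks. -/
def Hom.stalkMap {F G : OpenSystem X} (g : F.Hom G) (x : X) : F.stalk x ⟶ G.stalk x where
  app Δ := ↾fun σ => ⟨g.φ.app Δ σ.1, g.le σ.1 σ.2⟩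
  naturality _ _ f := ConcreteCategory.hom_ext _ _ fun σ =>
    Subtype.ext (NatTrans.naturality_apply g.φ f σ.1)

/-- A morphism of systems of open subsets is a local trivial fibration if it is a trivial
fibration on all stalks. -/
def Hom.IsLocalTrivialFibration {F G : OpenSystem X} (g : F.Hom G) : Prop :=
  ∀ x, IsTrivialFibration (g.stalkMap x)

/-- A system of open subsets is a hypercovering if all its stalks are trivial fibrations over the
point. -/
def IsHypercovering (F : OpenSystem X) : Prop :=
  ∀ x, IsTrivialFibration (toPoint (F.stalk x))

/-- Composition of morphisms of systems of open subsets. -/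
def Hom.comp {F G H : OpenSystem X} (f : F.Hom G) (g : G.Hom H) : F.Hom H where
  φ := f.φ ≫ g.φ
  le σ := (f.le σ).trans (g.le _)

lemma Hom.IsLocalTrivialFibration.comp {F G H : OpenSystem X} {f : F.Hom G} {g : G.Hom H}
    (hf : f.IsLocalTrivialFibration) (hg : g.IsLocalTrivialFibration) :
    (f.comp g).IsLocalTrivialFibration :=
  fun x => (hf x).comp (hg x)

lemma Hom.IsLocalTrivialFibration.isHypercovering {F G : OpenSystem X} {f : F.Hom G}
    (hf : f.IsLocalTrivialFibration) (hG : G.IsHypercovering) : F.IsHypercovering :=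
  fun x => (hf x).comp (hG x)

/-- In a hypercovering the open subsets of each level cover the space. -/
lemma IsHypercovering.exists_mem {F : OpenSystem X} (hF : F.IsHypercovering) (x : X)
    (Δ : SimplexCategoryᵒᵖ) : ∃ σ : F.K.obj Δ, x ∈ F.U σ := by
  obtain ⟨σ, -⟩ := (hF x).zero PUnit.unit
  exact ⟨_, F.le (SimplexCategory.const Δ.unop ⦋0⦌ 0).op _ σ.2⟩

/-- The system with one simplex in each dimension, carrying the whole space. -/
def terminal (X : Type u) [TopologicalSpace X] : OpenSystem X where
  K := pointSSet
  U _ := ⊤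
  le _ _ := le_rfl

lemma isHypercovering_terminal : (terminal X).IsHypercovering := fun x => by
  refine ⟨fun _ => ⟨⟨PUnit.unit, trivial⟩, rfl⟩, fun a b h => ⟨⟨PUnit.unit, trivial⟩, ?_, rfl⟩⟩
  intro Δ hΔ θ
  rfl

/-- The product of two systems: pairs of simplices with the intersection of their open
subsets. -/
def prod (F G : OpenSystem X) : OpenSystem X where
  K :=
    { obj := fun Δ => F.K.obj Δ × G.K.obj Δ
      map := fun θ => ↾fun σ => (F.K.map θ σ.1, G.K.map θ σ.2)
      map_id := fun Δ => by ext σ <;> simp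
      map_comp := fun f g => by ext σ <;> simp }
  U σ := F.U σ.1 ⊓ G.U σ.2
  le θ σ := inf_le_inf (F.le θ σ.1) (G.le θ σ.2)

/-- The first projection. -/
def fst (F G : OpenSystem X) : (F.prod G).Hom F where
  φ := { app := fun _ => ↾Prod.fst }
  le _ := inf_le_left

/-- The second projection. -/
def snd (F G : OpenSystem X) : (F.prod G).Hom G where
  φ := { app := fun _ => ↾Prod.snd }
  le _ := inf_le_right

lemma isLocalTrivialFibration_fst (F : OpenSystem X) {G : OpenSystem X}
    (hG : G.IsHypercovering) : (F.fst G).IsLocalTrivialFibration := fun x => by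
  refine ⟨fun σ => ?_, fun a b h => ?_⟩
  · obtain ⟨τ, -⟩ := (hG x).zero PUnit.unit
    exact ⟨⟨(σ.1, τ.1), σ.2, τ.2⟩, rfl⟩
  · obtain ⟨τ, hτ, -⟩ := (hG x).succ (a.map ((F.snd G).stalkMap x)) PUnit.unit
      (fun _ _ => rfl)
    refine ⟨⟨(b.1, τ.1), b.2, τ.2⟩, fun hΔ θ => ?_, rfl⟩
    exact Subtype.ext (Prod.ext (congrArg Subtype.val (h hΔ θ)) (congrArg Subtype.val (hτ hΔ θ)))

lemma isLocalTrivialFibration_snd {F : OpenSystem X} (G : OpenSystem X)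
    (hF : F.IsHypercovering) : (F.snd G).IsLocalTrivialFibration := fun x => by
  refine ⟨fun τ => ?_, fun a b h => ?_⟩
  · obtain ⟨σ, -⟩ := (hF x).zero PUnit.unit
    exact ⟨⟨(σ.1, τ.1), σ.2, τ.2⟩, rfl⟩
  · obtain ⟨σ, hσ, -⟩ := (hF x).succ (a.map ((F.fst G).stalkMap x)) PUnit.unit
      (fun _ _ => rfl)
    refine ⟨⟨(σ.1, b.1), σ.2, b.2⟩, fun hΔ θ => ?_, rfl⟩
    exact Subtype.ext (Prod.ext (congrArg Subtype.val (hσ hΔ θ)) (congrArg Subtype.val (h hΔ θ)))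

/-- The preimage of a system of open subsets under a continuous map. -/
def comap {X' : Type u} [TopologicalSpace X'] (f : C(X, X')) (F : OpenSystem X') :
    OpenSystem X where
  K := F.K
  U σ := Opens.comap f (F.U σ)
  le θ σ := OrderHomClass.mono (Opens.comap f) (F.le θ σ)

lemma IsHypercovering.comap {X' : Type u} [TopologicalSpace X'] (f : C(X, X'))
    {F : OpenSystem X'} (hF : F.IsHypercovering) : (F.comap f).IsHypercovering :=
  fun x => hF (f x)

end OpenSystem

/-! ### Finite subsets of simplices as faces -/

section Faces

/-- The set of vertices in the image of an operator. -/
abbrev imageVertices {Δ Δ' : SimplexCategory} (θ : Δ ⟶ Δ') : Finset (Fin (Δ'.len + 1)) :=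
  Finset.univ.image θ

lemma imageVertices_comp {Δ Δ' Δ'' : SimplexCategory} (θ : Δ ⟶ Δ') (ψ : Δ' ⟶ Δ'') :
    imageVertices (θ ≫ ψ) = (imageVertices θ).image ψ := by
  rw [imageVertices, imageVertices, Finset.image_image]
  rfl

lemma imageVertices_id (Δ : SimplexCategory) : imageVertices (𝟙 Δ) = Finset.univ := by
  ext; simp [imageVertices]

/-- Operators into `Δ` with vertices in the image of an injective operator factor through it. -/
lemma exists_fac_of_imageVertices_subset {Δ Δ' Δ'' : SimplexCategory} (θ : Δ' ⟶ Δ) (ι : Δ'' ⟶ Δ)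
    [Mono ι] (h : imageVertices θ ⊆ imageVertices ι) : ∃ ψ : Δ' ⟶ Δ'', ψ ≫ ι = θ := by
  have hι : StrictMono ι.toOrderHom :=
    ι.toOrderHom.monotone.strictMono_of_injective (SimplexCategory.mono_iff_injective.1 ‹_›)
  have h' : ∀ i, ∃ j, ι.toOrderHom j = θ.toOrderHom i := fun i => by
    have := h (Finset.mem_image_of_mem θ (Finset.mem_univ i))
    obtain ⟨j, -, hj⟩ := Finset.mem_image.1 this
    exact ⟨j, hj⟩
  choose f hf using h'
  refine ⟨SimplexCategory.Hom.mk ⟨f, fun i j hij => ?_⟩, ?_⟩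
  · rw [← hι.le_iff_le, hf, hf]
    exact θ.toOrderHom.monotone hij
  · ext i : 3
    exact hf i

/-- The face with a given nonempty set of vertices. -/
lemma exists_mono_imageVertices_eq {Δ : SimplexCategory} (S : Finset (Fin (Δ.len + 1)))
    (hS : S.Nonempty) :
    ∃ (Δ' : SimplexCategory) (ι : Δ' ⟶ Δ), Mono ι ∧ Δ'.len + 1 = S.card ∧ imageVertices ι = S := by
  have h : S.card = S.card - 1 + 1 := by have := hS.card_pos; omega
  refine ⟨⦋S.card - 1⦌, SimplexCategory.Hom.mk (S.orderEmbOfFin h).toOrderHom, ?_, h.symm, ?_⟩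
  · rw [SimplexCategory.mono_iff_injective]
    exact (S.orderEmbOfFin h).injective
  · exact Finset.image_orderEmbOfFin_univ S h

end Faces

namespace OpenSystem

variable {X : Type u} [TopologicalSpace X]

/-! ### Refinement by prescribed families of open subsets -/

/-- The condition on families `W` of open subsets indexed by the faces of a simplex that
defines the refinement of `F` by the sets `P`. The value at the empty face is irrelevant, and
fixed to be `⊤`. -/
structure IsRefiningFamily (F : OpenSystem X) (P : ℕ → Set (Opens X)) {Δ : SimplexCategory}
    (σ : F.K.obj (op Δ)) (W : Finset (Fin (Δ.len + 1)) → Opens X) : Prop where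
  empty : W ∅ = ⊤
  mem (S) : S.Nonempty → W S ∈ P S.card
  anti : Antitone W
  le {Δ' : SimplexCategory} (θ : Δ' ⟶ Δ) : W (imageVertices θ) ≤ F.U (F.K.map θ.op σ)

lemma IsRefiningFamily.map {F : OpenSystem X} {P : ℕ → Set (Opens X)} (hP : Monotone P)
    {Δ Δ' : SimplexCategory} {σ : F.K.obj (op Δ)} {W : Finset (Fin (Δ.len + 1)) → Opens X}
    (h : F.IsRefiningFamily P σ W) (θ : Δ' ⟶ Δ) :
    F.IsRefiningFamily P (F.K.map θ.op σ) (fun S => W (S.image θ)) where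
  empty := by simpa using h.empty
  mem S hS := hP Finset.card_image_le (h.mem _ (hS.image _))
  anti S T hST := h.anti (Finset.image_subset_image hST)
  le ψ := by
    rw [← imageVertices_comp, ← ConcreteCategory.comp_apply, ← Functor.map_comp, ← op_comp]
    exact h.le _

/-- The refinement of the system `F` by the sets `P n` of open subsets: its simplices are
the simplices `σ` of `F` together with a family of open subsets `W S`, indexed by the nonempty
faces `S` of `σ`, which is decreasing in `S`, with `W S` in `P (card S)` and contained in the open
subset of the face `S` of `σ`. -/
def refine (F : OpenSystem X) (P : ℕ → Set (Opens X)) (hP : Monotone P) : OpenSystem X where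
  K :=
    { obj := fun Δ => {p : F.K.obj Δ × (Finset (Fin (Δ.unop.len + 1)) → Opens X) //
        F.IsRefiningFamily P (Δ := Δ.unop) p.1 p.2}
      map := fun θ => ↾fun p => ⟨(F.K.map θ p.1.1, fun S => p.1.2 (S.image θ.unop)),
        p.2.map hP θ.unop⟩
      map_id := fun Δ => ConcreteCategory.hom_ext _ _ fun σ => Subtype.ext (Prod.ext
        (ConcreteCategory.congr_hom (F.K.map_id Δ) σ.1.1)
        (funext fun S => congrArg σ.1.2 (Finset.image_id (s := S))))
      map_comp := fun f g => ConcreteCategory.hom_ext _ _ fun σ => Subtype.ext (Prod.ext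
        (ConcreteCategory.congr_hom (F.K.map_comp f g) σ.1.1)
        (funext fun S => congrArg σ.1.2
          (Finset.image_image (s := S) (f := g.unop) (g := f.unop)).symm)) }
  U p := p.1.2 Finset.univ
  le _ p := p.2.anti (Finset.subset_univ _)

section

variable (F : OpenSystem X) {P : ℕ → Set (Opens X)} (hP : Monotone P)

/-- The underlying simplex of `F` of a simplex of the refinement. -/
def refineBase {Δ : SimplexCategoryᵒᵖ} (p : (F.refine P hP).K.obj Δ) : F.K.obj Δ :=
  (show {p : F.K.obj Δ × (Finset (Fin (Δ.unop.len + 1)) → Opens X) //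
    F.IsRefiningFamily P (Δ := Δ.unop) p.1 p.2} from p).1.1

/-- The family of open subsets of a simplex of the refinement. -/
def refineFamily {Δ : SimplexCategoryᵒᵖ} (p : (F.refine P hP).K.obj Δ) :
    Finset (Fin (Δ.unop.len + 1)) → Opens X :=
  (show {p : F.K.obj Δ × (Finset (Fin (Δ.unop.len + 1)) → Opens X) //
    F.IsRefiningFamily P (Δ := Δ.unop) p.1 p.2} from p).1.2

lemma isRefiningFamily_refineFamily {Δ : SimplexCategoryᵒᵖ} (p : (F.refine P hP).K.obj Δ) :
    F.IsRefiningFamily P (Δ := Δ.unop) (F.refineBase hP p) (F.refineFamily hP p) :=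
  (show {p : F.K.obj Δ × (Finset (Fin (Δ.unop.len + 1)) → Opens X) //
    F.IsRefiningFamily P (Δ := Δ.unop) p.1 p.2} from p).2

lemma refine_ext {Δ : SimplexCategoryᵒᵖ} {p q : (F.refine P hP).K.obj Δ}
    (h : F.refineBase hP p = F.refineBase hP q) (h' : F.refineFamily hP p = F.refineFamily hP q) :
    p = q :=
  Subtype.ext (Prod.ext h h')

/-- Constructor for simplices of the refinement. -/
def refineMk {Δ : SimplexCategoryᵒᵖ} (σ : F.K.obj Δ)
    (W : Finset (Fin (Δ.unop.len + 1)) → Opens X)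
    (h : F.IsRefiningFamily P (Δ := Δ.unop) σ W) : (F.refine P hP).K.obj Δ :=
  (⟨(σ, W), h⟩ : {p : F.K.obj Δ × (Finset (Fin (Δ.unop.len + 1)) → Opens X) //
    F.IsRefiningFamily P (Δ := Δ.unop) p.1 p.2})

/-- The projection from the refinement. -/
def refineHom : (F.refine P hP).Hom F where
  φ := { app := fun _ => ↾fun p => F.refineBase hP p }
  le {Δ} p := by
    have := (F.isRefiningFamily_refineFamily hP p).le (𝟙 Δ.unop)
    rw [imageVertices_id] at this
    refine this.trans (le_of_eq ?_)
    congr 1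
    exact ConcreteCategory.congr_hom (F.K.map_id Δ) (F.refineBase hP p)

lemma refine_U_mem {Δ : SimplexCategoryᵒᵖ} (p : (F.refine P hP).K.obj Δ) :
    (F.refine P hP).U p ∈ P (Δ.unop.len + 1) := by
  have := (F.isRefiningFamily_refineFamily hP p).mem Finset.univ Finset.univ_nonempty
  rwa [Finset.card_univ, Fintype.card_fin] at this

lemma finite_refine (hfin : ∀ n, (P n).Finite) (Δ : SimplexCategoryᵒᵖ) [Finite (F.K.obj Δ)] :
    Finite ((F.refine P hP).K.obj Δ) := by
  have : Finite (insert ⊤ (P (Δ.unop.len + 1)) : Set (Opens X)) := ((hfin _).insert _)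
  refine Finite.of_injective
    (β := F.K.obj Δ × (Finset (Fin (Δ.unop.len + 1)) →
      (insert ⊤ (P (Δ.unop.len + 1)) : Set (Opens X))))
    (fun p => (F.refineBase hP p, fun S => ⟨F.refineFamily hP p S, ?_⟩)) (fun p q h => ?_)
  · rcases S.eq_empty_or_nonempty with rfl | hS
    · exact Or.inl (F.isRefiningFamily_refineFamily hP p).empty
    · refine Or.inr (hP ?_ ((F.isRefiningFamily_refineFamily hP p).mem S hS))
      exact S.card_le_univ.trans (by simp)
  · have hb : F.refineBase hP p = F.refineBase hP q := (Prod.mk.inj h).1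
    refine F.refine_ext hP hb ?_
    funext S
    exact congrArg Subtype.val (congrFun (Prod.mk.inj h).2 S)

/-- If finite intersections of members of `P n` and an open subset of an `n`-simplex of `F` are
covered by members of `P (n + 1)`, then the refinement of `F` by `P` is a local trivial
fibration over `F`. -/
lemma isLocalTrivialFibration_refineHom
    (h : ∀ (n : ℕ) (s : Set (Opens X)), s ⊆ P n → ∀ (σ : F.K.obj (op ⦋n⦌)) (x : X),
      (∀ W ∈ s, x ∈ W) → x ∈ F.U σ → ∃ W ∈ P (n + 1), x ∈ W ∧ (∀ W' ∈ s, W ≤ W') ∧ W ≤ F.U σ) :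
    (F.refineHom hP).IsLocalTrivialFibration := fun x => by
  constructor
  · intro σ
    obtain ⟨W, hW, hxW, -, hWσ⟩ := h 0 ∅ (Set.empty_subset _) σ.1 x (by simp) σ.2
    refine ⟨⟨F.refineMk hP σ.1 (fun S => if S = ∅ then ⊤ else W) ⟨?_, ?_, ?_, ?_⟩, ?_⟩, rfl⟩
    · simp
    · intro S hS
      rw [if_neg hS.ne_empty]
      exact hP hS.card_pos hW
    · intro S T hST
      by_cases hS : S = ∅
      · simp [hS]
      · have hT : T ≠ ∅ := fun hT => hS (Finset.subset_empty.1 (hT ▸ hST))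
        simp [hS, hT]
    · intro Δ' θ
      have : imageVertices θ ≠ ∅ := (Finset.univ_nonempty.image _).ne_empty
      rw [if_neg this]
      exact hWσ.trans (F.le _ _)
    · change x ∈ if (Finset.univ : Finset (Fin (0 + 1))) = ∅ then (⊤ : Opens X) else W
      rw [if_neg Finset.univ_nonempty.ne_empty]
      exact hxW
  · intro n a b hab
    -- the prescribed value on a proper face `S` is the top value of the datum at the face `S`
    have hface : ∀ S : Finset (Fin (n + 1 + 1)), ∃ V : Opens X, ∀ (Δ : SimplexCategory)
        (hΔ : Δ.len ≤ n) (θ : Δ ⟶ ⦋n + 1⦌), imageVertices θ = S →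
        F.refineFamily hP (a.val hΔ θ).1 Finset.univ = V := by
      intro S
      by_cases hS : S.Nonempty ∧ S.card ≤ n + 1
      · obtain ⟨Δ', ι, hι, hc, hι'⟩ := exists_mono_imageVertices_eq (Δ := ⦋n + 1⦌) S hS.1
        have hΔ' : Δ'.len ≤ n := by have := hS.2; omega
        refine ⟨F.refineFamily hP (a.val hΔ' ι).1 Finset.univ, fun Δ hΔ θ hθ => ?_⟩
        obtain ⟨e, rfl⟩ := exists_fac_of_imageVertices_subset θ ι (by rw [hθ, hι'])
        rw [← a.comp hΔ' hΔ]
        change F.refineFamily hP (a.val hΔ' ι).1 (imageVertices e) = _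
        congr 1
        refine Finset.image_injective (SimplexCategory.mono_iff_injective.1 hι) ?_
        rw [imageVertices_comp] at hθ
        exact hθ.trans hι'.symm
      · refine ⟨⊤, fun Δ hΔ θ hθ => (hS ?_).elim⟩
        subst hθ
        refine ⟨Finset.univ_nonempty.image _, Finset.card_image_le.trans ?_⟩
        simp; omega
    choose V hV using hface
    have hfaceι : ∀ S : Finset (Fin (n + 1 + 1)), S.Nonempty → S ≠ Finset.univ →
        ∃ (Δ : SimplexCategory) (hΔ : Δ.len ≤ n) (ι : Δ ⟶ ⦋n + 1⦌), Mono ι ∧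
          Δ.len + 1 = S.card ∧ imageVertices ι = S := by
      intro S hS hS'
      obtain ⟨Δ', ι, hι, hc, hι'⟩ := exists_mono_imageVertices_eq (Δ := ⦋n + 1⦌) S hS
      refine ⟨Δ', ?_, ι, hι, hc, hι'⟩
      have := Finset.card_lt_card (Finset.ssubset_univ_iff.2 hS')
      rw [Finset.card_univ, Fintype.card_fin] at this
      omega
    have hVmem : ∀ S : Finset (Fin (n + 1 + 1)), S.Nonempty → S ≠ Finset.univ →
        V S ∈ P S.card ∧ V S ∈ P (n + 1) ∧ x ∈ V S := by
      intro S hS hS'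
      obtain ⟨Δ, hΔ, ι, hι, hc, hι'⟩ := hfaceι S hS hS'
      have h1 := refine_U_mem F hP (a.val hΔ ι).1
      have h2 := (a.val hΔ ι).2
      change F.refineFamily hP (a.val hΔ ι).1 Finset.univ ∈ _ at h1
      change x ∈ F.refineFamily hP (a.val hΔ ι).1 Finset.univ at h2
      rw [hV S Δ hΔ ι hι'] at h1 h2
      refine ⟨hc ▸ h1, hP ?_ h1, h2⟩
      simpa using hΔ
    have hVle : ∀ S T : Finset (Fin (n + 1 + 1)), S.Nonempty → T ≠ Finset.univ → S ⊆ T →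
        V T ≤ V S := by
      intro S T hS hT hST
      obtain ⟨Δ, hΔ, ι, hι, hc, hι'⟩ := hfaceι T (hS.mono hST) hT
      obtain ⟨Δ', hΔ', ι', hι2, hc', hι3⟩ := hfaceι S hS
        (fun h => hT (Finset.univ_subset_iff.1 (h ▸ hST)))
      obtain ⟨e, rfl⟩ := exists_fac_of_imageVertices_subset ι' ι (by rw [hι3, hι']; exact hST)
      rw [← hV S Δ' hΔ' _ hι3, ← hV T Δ hΔ _ hι', ← a.comp hΔ hΔ']
      exact (F.isRefiningFamily_refineFamily hP (a.val hΔ ι).1).anti (Finset.subset_univ _)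
    -- the value on the full simplex is a member of `P (n + 2)` contained in all prescribed values
    obtain ⟨W, hW, hxW, hWV, hWσ⟩ := h (n + 1)
      {V' | ∃ S : Finset (Fin (n + 1 + 1)), S.Nonempty ∧ S ≠ Finset.univ ∧ V S = V'}
      (by rintro _ ⟨S, hS, hS', rfl⟩; exact (hVmem S hS hS').2.1) b.1 x
      (by rintro _ ⟨S, hS, hS', rfl⟩; exact (hVmem S hS hS').2.2) b.2
    let W' : Finset (Fin (n + 1 + 1)) → Opens X := fun S =>
      if S = ∅ then ⊤ else if S = Finset.univ then W else V S
    have hW'univ : W' Finset.univ = W := by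
      simp only [W']
      rw [if_neg Finset.univ_nonempty.ne_empty]
      simp
    have hW'V : ∀ S : Finset (Fin (n + 1 + 1)), S.Nonempty → S ≠ Finset.univ → W' S = V S := by
      intro S hS hS'
      simp only [W']
      rw [if_neg hS.ne_empty, if_neg hS']
    have hne : ∀ {Δ : SimplexCategory} (hΔ : Δ.len ≤ n) (θ : Δ ⟶ ⦋n + 1⦌),
        imageVertices θ ≠ Finset.univ := by
      intro Δ hΔ θ hθ
      have h1 := congrArg Finset.card hθ
      have h2 : (imageVertices θ).card ≤ _ := Finset.card_image_le
      simp at h1 h2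
      omega
    have hW' : F.IsRefiningFamily P (Δ := ⦋n + 1⦌) b.1 W' := by
      constructor
      · simp [W']
      · intro S hS
        by_cases hS' : S = Finset.univ
        · subst hS'
          rw [hW'univ]
          simpa using hW
        · rw [hW'V S hS hS']
          exact (hVmem S hS hS').1
      · intro S T hST
        rcases S.eq_empty_or_nonempty with rfl | hS
        · simp [W']
        by_cases hT : T = Finset.univ
        · subst hT
          rw [hW'univ]
          by_cases hS' : S = Finset.univ
          · subst hS'
            rw [hW'univ]
          · rw [hW'V S hS hS']
            exact hWV _ ⟨S, hS, hS', rfl⟩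
        · rw [hW'V S hS (fun h => hT (Finset.univ_subset_iff.1 (h ▸ hST))),
            hW'V T (hS.mono hST) hT]
          exact hVle S T hS hT hST
      · intro Δ' θ
        by_cases hθ : imageVertices θ = Finset.univ
        · rw [hθ, hW'univ]
          exact hWσ.trans (F.le _ _)
        · have hθ' : (imageVertices θ).Nonempty := Finset.univ_nonempty.image _
          rw [hW'V _ hθ' hθ]
          obtain ⟨Δ, hΔ, ι, hι, hc, hι'⟩ := hfaceι _ hθ' hθ
          obtain ⟨e, rfl⟩ := exists_fac_of_imageVertices_subset θ ι (by rw [hι'])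
          rw [← hV _ Δ hΔ ι hι']
          refine ((F.refineHom hP).le (a.val hΔ ι).1).trans ?_
          have := congrArg Subtype.val (hab hΔ ι)
          change F.K.map ι.op b.1 = F.refineBase hP (a.val hΔ ι).1 at this
          change F.U (F.refineBase hP (a.val hΔ ι).1) ≤ _
          rw [← this, op_comp, Functor.map_comp, ConcreteCategory.comp_apply]
          exact F.le _ _
    refine ⟨⟨F.refineMk hP b.1 W' hW', ?_⟩, fun {Δ} hΔ θ => ?_, rfl⟩
    · change x ∈ W' _
      rw [hW'univ]
      exact hxW
    · refine Subtype.ext (F.refine_ext hP (congrArg Subtype.val (hab hΔ θ)) ?_)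
      funext S
      change W' (S.image θ) = F.refineFamily hP (a.val hΔ θ).1 S
      rcases S.eq_empty_or_nonempty with rfl | hS
      · rw [(F.isRefiningFamily_refineFamily hP (a.val hΔ θ).1).empty]
        simp [W']
      · obtain ⟨Δ', ι, hι, hc, rfl⟩ := exists_mono_imageVertices_eq (Δ := Δ) S hS
        have hΔ' : Δ'.len ≤ n := (SimplexCategory.len_le_of_mono ι).trans hΔ
        rw [← imageVertices_comp, hW'V _ (Finset.univ_nonempty.image _) (hne hΔ' _),
          ← hV _ Δ' hΔ' (ι ≫ θ) rfl, ← a.comp hΔ hΔ']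
        rfl

end

end OpenSystem

end

/-! ### Points of coskeleta -/

section CoskPoints

universe v w

variable {C : Type w} [Category.{v} C] [HasFiniteLimits C]

lemma hasPointwiseRightKanExtension_inclusion (n : ℕ) (F : (SimplexCategory.Truncated n)ᵒᵖ ⥤ C) :
    (SimplexCategory.Truncated.inclusion n).op.HasPointwiseRightKanExtension F := fun d => by
  let _ : FinCategory (StructuredArrow d (SimplexCategory.Truncated.inclusion n).op) :=
    { fintypeObj := Fintype.ofFinite _
      fintypeHom := fun _ _ => Fintype.ofFinite _ }
  have : HasLimitsOfShape
      (StructuredArrow d (SimplexCategory.Truncated.inclusion n).op) C :=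
    HasFiniteLimits.out _
  exact inferInstanceAs (HasLimit _)

/-- The diagram whose limit is `cosk_n(sk_n(Y))_{n+1}`. -/
abbrev coskSuccDiagram (n : ℕ) (Y : SimplicialObject C) :
    StructuredArrow (op ⦋n + 1⦌) (SimplexCategory.Truncated.inclusion n).op ⥤ C :=
  StructuredArrow.proj (op ⦋n + 1⦌) (SimplexCategory.Truncated.inclusion n).op ⋙
    (SimplicialObject.truncation n).obj Y

/-- The limit cone with point `cosk_n(sk_n(Y))_{n+1}`. -/
noncomputable def coskSuccCone (n : ℕ) (Y : SimplicialObject C) : Cone (coskSuccDiagram n Y) :=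
  (Functor.RightExtension.mk ((SimplicialObject.cosk n).obj Y)
    ((SimplicialObject.coskAdj n).counit.app ((SimplicialObject.truncation n).obj Y))).coneAt
      (op ⦋n + 1⦌)

/-- The coskeleton is computed by a limit. -/
noncomputable def isLimitCoskSuccCone (n : ℕ) (Y : SimplicialObject C) :
    IsLimit (coskSuccCone n Y) :=
  have : (SimplexCategory.Truncated.inclusion n).op.HasPointwiseRightKanExtension
      ((𝟭 (SimplicialObject.Truncated C n)).obj ((SimplicialObject.truncation n).obj Y)) :=
    hasPointwiseRightKanExtension_inclusion n ((SimplicialObject.truncation n).obj Y)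
  Functor.isPointwiseRightKanExtensionOfIsRightKanExtension
    ((SimplicialObject.cosk n).obj Y)
    ((SimplicialObject.coskAdj n).counit.app ((SimplicialObject.truncation n).obj Y)) (op ⦋n + 1⦌)

/-- The projection of `cosk_n(sk_n(Y))_{n+1}` to `Y_m` attached to an operator `θ`. -/
noncomputable def coskSuccProj {n : ℕ} (Y : SimplicialObject C) {Δ : SimplexCategory}
    (hΔ : Δ.len ≤ n) (θ : Δ ⟶ ⦋n + 1⦌) : coskSucc n Y ⟶ Y.obj (op Δ) :=
  ((SimplicialObject.cosk n).obj Y).map θ.op ≫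
    ((SimplicialObject.coskAdj n).counit.app ((SimplicialObject.truncation n).obj Y)).app
      (op ⟨Δ, hΔ⟩)

lemma toCoskSucc_proj {n : ℕ} (Y : SimplicialObject C) {Δ : SimplexCategory}
    (hΔ : Δ.len ≤ n) (θ : Δ ⟶ ⦋n + 1⦌) :
    toCoskSucc n Y ≫ coskSuccProj Y hΔ θ = Y.map θ.op := by
  have h := NatTrans.congr_app ((SimplicialObject.coskAdj (C := C) n).left_triangle_components Y)
    (op ⟨Δ, hΔ⟩)
  have h2 := ((SimplicialObject.coskAdj (C := C) n).unit.app Y).naturality θ.op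
  exact (Category.assoc _ _ _).symm.trans ((congrArg (· ≫ _) h2.symm).trans
    ((Category.assoc _ _ _).trans ((congrArg (Y.map θ.op ≫ ·) h).trans (Category.comp_id _))))

lemma coskSuccMap_proj {n : ℕ} {V Y : SimplicialObject C} (g : V ⟶ Y) {Δ : SimplexCategory}
    (hΔ : Δ.len ≤ n) (θ : Δ ⟶ ⦋n + 1⦌) :
    coskSuccMap n g ≫ coskSuccProj Y hΔ θ = coskSuccProj V hΔ θ ≫ g.app (op Δ) := by
  have h := NatTrans.congr_app ((SimplicialObject.coskAdj (C := C) n).counit.naturality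
    ((SimplicialObject.truncation n).map g)) (op ⟨Δ, hΔ⟩)
  have h2 := ((SimplicialObject.cosk n).map g).naturality θ.op
  exact (Category.assoc _ _ _).symm.trans ((congrArg (· ≫ _) h2.symm).trans
    ((Category.assoc _ _ _).trans ((congrArg (((SimplicialObject.cosk n).obj V).map θ.op ≫ ·)
      h).trans (Category.assoc _ _ _).symm)))

lemma coskSucc_hom_ext {n : ℕ} {Y : SimplicialObject C} {T : C} {z z' : T ⟶ coskSucc n Y}
    (h : ∀ {Δ : SimplexCategory} (hΔ : Δ.len ≤ n) (θ : Δ ⟶ ⦋n + 1⦌),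
      z ≫ coskSuccProj Y hΔ θ = z' ≫ coskSuccProj Y hΔ θ) : z = z' :=
  (isLimitCoskSuccCone n Y).hom_ext fun j => h j.right.unop.2 j.hom.unop

/-- The simplicial set of `T`-valued points of a simplicial object. -/
abbrev points (T : C) (Y : SimplicialObject C) : SSet.{v} :=
  Y ⋙ coyoneda.obj (op T)

/-- A `T`-valued point of `cosk_n(sk_n(Y))_{n+1}` gives a matching family. -/
noncomputable def matchingOfPoint {n : ℕ} {Y : SimplicialObject C} {T : C}
    (z : T ⟶ coskSucc n Y) : Matching (points T Y) n where
  val hΔ θ := z ≫ coskSuccProj Y hΔ θ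
  comp {Δ Δ'} h h' ψ θ := by
    have h1 := ((SimplicialObject.coskAdj (C := C) n).counit.app
      ((SimplicialObject.truncation n).obj Y)).naturality
        (X := op ⟨Δ, h⟩) (Y := op ⟨Δ', h'⟩) (Quiver.Hom.op (ObjectProperty.homMk ψ))
    refine (Category.assoc _ _ _).trans (congrArg (z ≫ ·) ?_)
    refine (Category.assoc _ _ _).trans ((congrArg
      (((SimplicialObject.cosk n).obj Y).map θ.op ≫ ·) h1.symm).trans ?_)
    refine (Category.assoc _ _ _).symm.trans (congrArg (· ≫ _) ?_)
    exact (((SimplicialObject.cosk n).obj Y).map_comp θ.op ψ.op).symm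

/-- A matching family of `T`-valued points comes from a point of `cosk_n(sk_n(Y))_{n+1}`. -/
lemma exists_point_of_matching {n : ℕ} {Y : SimplicialObject C} {T : C}
    (a : Matching (points T Y) n) : ∃ z : T ⟶ coskSucc n Y,
      ∀ {Δ : SimplexCategory} (hΔ : Δ.len ≤ n) (θ : Δ ⟶ ⦋n + 1⦌),
        z ≫ coskSuccProj Y hΔ θ = a.val hΔ θ := by
  let c : Cone (coskSuccDiagram n Y) :=
    { pt := T
      π :=
        { app := fun j => a.val j.right.unop.2 j.hom.unop
          naturality := fun i j f => by
            have h := a.comp i.right.unop.2 j.right.unop.2 f.right.unop.hom i.hom.unop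
            refine (Category.id_comp _).trans (Eq.trans ?_ h.symm)
            have hw := StructuredArrow.w f
            congr 1
            exact (congrArg Quiver.Hom.unop hw).symm } }
  exact ⟨(isLimitCoskSuccCone n Y).lift c, fun {Δ} hΔ θ =>
    (isLimitCoskSuccCone n Y).fac c (StructuredArrow.mk
      (T := (SimplexCategory.Truncated.inclusion n).op) (Y := (op ⟨Δ, hΔ⟩ : (SimplexCategory.Truncated n)ᵒᵖ)) θ.op)⟩

end CoskPoints

/-! ### Étale simplicial schemes and their field-valued points -/

section Etale

variable {X : Scheme.{u}}

/-- A finite limit of étale `X`-schemes is étale, since the inclusion of the étale `X`-schemes in all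
`X`-schemes preserves finite limits. -/
lemma etale_of_isLimit {J : Type} [SmallCategory J] [FinCategory J] {D : J ⥤ Over X}
    (hD : ∀ j, Etale (D.obj j).hom) {c : Cone D} (hc : IsLimit c) : Etale c.pt.hom := by
  let D' : J ⥤ X.Etale :=
    { obj := fun j => ⟨(D.obj j), hD j⟩
      map := fun f => MorphismProperty.Over.Hom.mk (D.map f) trivial
      map_id := fun j => (Scheme.Etale.forget X).map_injective (D.map_id j)
      map_comp := fun f g => (Scheme.Etale.forget X).map_injective (D.map_comp f g) }
  let e : D' ⋙ Scheme.Etale.forget X ≅ D := Iso.refl _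
  let hL := isLimitOfPreserves (Scheme.Etale.forget X) (limit.isLimit D')
  let i : (Scheme.Etale.forget X).obj (limit D') ≅ c.pt :=
    IsLimit.conePointsIsoOfNatIso hL hc e
  have hi : IsIso i.inv.left := inferInstanceAs (IsIso ((Over.forget X).map i.inv))
  have : c.pt.hom = i.inv.left ≫ ((Scheme.Etale.forget X).obj (limit D')).hom :=
    (Over.w i.inv).symm
  rw [this]
  have h : Etale ((Scheme.Etale.forget X).obj (limit D')).hom := (limit D').prop
  exact Etale.etale_comp i.inv.left _

lemma etale_left_of_etale {A B : Over X} (f : A ⟶ B) (hA : Etale A.hom) (hB : Etale B.hom) :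
    Etale f.left := by
  have : Etale (f.left ≫ B.hom) := by rwa [Over.w]
  exact Etale.of_comp f.left B.hom

lemma etale_coskSucc {Y : SimplicialObject (Over X)} (hY : ∀ Δ, Etale (Y.obj Δ).hom) (n : ℕ) :
    Etale (coskSucc n Y).hom := by
  let F : FinCategory (StructuredArrow (op ⦋n + 1⦌) (SimplexCategory.Truncated.inclusion n).op) :=
    { fintypeObj := Fintype.ofFinite _
      fintypeHom := fun _ _ => Fintype.ofFinite _ }
  exact etale_of_isLimit (D := coskSuccDiagram n Y) (fun j => hY _) (isLimitCoskSuccCone n Y)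

lemma surjective_left_of_fieldPoints {A B : Over X} (f : A ⟶ B)
    (h : ∀ (L : Type u) [Field L] (t : Spec (CommRingCat.of L) ⟶ X) (b : Over.mk t ⟶ B),
      ∃ a : Over.mk t ⟶ A, a ≫ f = b) : Surjective f.left := by
  constructor
  intro b
  obtain ⟨a, ha⟩ := h (B.left.residueField b) (B.left.fromSpecResidueField b ≫ B.hom)
    (Over.homMk (B.left.fromSpecResidueField b))
  let pt : Spec (B.left.residueField b) := IsLocalRing.closedPoint _
  refine ⟨a.left pt, ?_⟩
  rw [← Scheme.Hom.comp_apply, ← Over.comp_left, ha]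
  exact Scheme.fromSpecResidueField_apply b pt

/-- If the field-valued points of an étale simplicial scheme over `X` form simplicial sets which
are trivial fibrations over the point, then it satisfies the covering conditions in the
definition of an étale hypercovering. -/
lemma etaleSurjective_toCoskSucc {Y : SimplicialObject (Over X)}
    (hY : ∀ Δ, Etale (Y.obj Δ).hom)
    (h : ∀ (L : Type u) [Field L] (t : Spec (CommRingCat.of L) ⟶ X),
      IsTrivialFibration (toPoint (points (Over.mk t) Y))) (n : ℕ) :
    EtaleSurjective (toCoskSucc n Y).left := by
  refine ⟨etale_left_of_etale _ (hY _) (etale_coskSucc hY n), surjective_left_of_fieldPoints _ ?_⟩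
  intro L _ t z
  obtain ⟨c, hc, -⟩ := (h L t).succ (matchingOfPoint z) PUnit.unit (fun _ _ => rfl)
  refine ⟨c, coskSucc_hom_ext fun hΔ θ => ?_⟩
  rw [Category.assoc, toCoskSucc_proj]
  exact hc hΔ θ

lemma etaleSurjective_zero {Y : SimplicialObject (Over X)}
    (hY : ∀ Δ, Etale (Y.obj Δ).hom)
    (h : ∀ (L : Type u) [Field L] (t : Spec (CommRingCat.of L) ⟶ X),
      IsTrivialFibration (toPoint (points (Over.mk t) Y))) :
    EtaleSurjective (Y _⦋0⦌).hom := by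
  refine ⟨hY _, ?_⟩
  have := surjective_left_of_fieldPoints (Over.mkIdTerminal.from (Y _⦋0⦌)) ?_
  · have hw : (Over.mkIdTerminal.from (Y _⦋0⦌)).left = (Y _⦋0⦌).hom := by
      simp
    rwa [hw] at this
  · intro L _ t z
    obtain ⟨c, -⟩ := (h L t).zero PUnit.unit
    exact ⟨c, Over.mkIdTerminal.hom_ext _ _⟩

/-- A morphism of étale simplicial schemes over `X` which induces trivial fibrations on
field-valued points is a refinement. -/
lemma isRefinement_of_points {V Y : SimplicialObject (Over X)} (g : V ⟶ Y)
    (hV : IsEtaleHypercovering V) (hY : IsEtaleHypercovering Y)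
    (hV' : ∀ Δ, Etale (V.obj Δ).hom) (hY' : ∀ Δ, Etale (Y.obj Δ).hom)
    (h : ∀ (L : Type u) [Field L] (t : Spec (CommRingCat.of L) ⟶ X),
      IsTrivialFibration (Functor.whiskerRight g (coyoneda.obj (op (Over.mk t))))) :
    IsRefinement g where
  source := hV
  target := hY
  zero := by
    refine ⟨etale_left_of_etale _ (hV' _) (hY' _), surjective_left_of_fieldPoints _ ?_⟩
    intro L _ t z
    exact (h L t).zero z
  succ n := by
    have hP : Etale (pullback (coskSuccMap n g) (toCoskSucc n Y)).hom :=
      etale_of_isLimit (D := cospan (coskSuccMap n g) (toCoskSucc n Y))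
        (fun j => by
          rcases j with _ | _ | _
          · exact etale_coskSucc hY' n
          · exact etale_coskSucc hV' n
          · exact hY' _) (limit.isLimit _)
    refine ⟨etale_left_of_etale _ (hV' _) hP, surjective_left_of_fieldPoints _ ?_⟩
    intro L _ t z
    obtain ⟨c, hc, hc'⟩ := (h L t).succ (matchingOfPoint (z ≫ pullback.fst _ _))
      (z ≫ pullback.snd _ _) (fun {Δ} hΔ θ => by
        change (z ≫ pullback.snd _ _) ≫ Y.map θ.op =
          ((z ≫ pullback.fst _ _) ≫ coskSuccProj V hΔ θ) ≫ g.app (op Δ)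
        rw [← toCoskSucc_proj Y hΔ, Category.assoc, Category.assoc, Category.assoc,
          ← coskSuccMap_proj, pullback.condition_assoc])
    refine ⟨c, pullback.hom_ext (coskSucc_hom_ext fun hΔ θ => ?_) ?_⟩
    · have h1 : relativeToCoskSucc n g ≫ pullback.fst _ _ = toCoskSucc n V :=
        pullback.lift_fst _ _ _
      rw [Category.assoc c, h1, Category.assoc, toCoskSucc_proj]
      exact hc hΔ θ
    · rw [Category.assoc, relativeToCoskSucc, pullback.lift_snd]
      exact hc'

/-- In an étale hypercovering, matching families of field-valued points can be filled after
a field extension. -/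
lemma IsEtaleHypercovering.exists_fill {Y : SimplicialObject (Over X)}
    (hY : IsEtaleHypercovering Y) {n : ℕ} {L : Type u} [Field L]
    {t : Spec (CommRingCat.of L) ⟶ X} (a : Matching (points (Over.mk t) Y) n) :
    ∃ (L' : Type u) (_ : Field L') (t' : Spec (CommRingCat.of L') ⟶ X) (i : Over.mk t' ⟶ Over.mk t)
      (c : Over.mk t' ⟶ Y _⦋n + 1⦌), ∀ {Δ : SimplexCategory} (hΔ : Δ.len ≤ n) (θ : Δ ⟶ ⦋n + 1⦌),
        c ≫ Y.map θ.op = i ≫ a.val hΔ θ := by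
  obtain ⟨z, hz⟩ := exists_point_of_matching a
  have hs : Surjective (toCoskSucc n Y).left := (hY.succ n).2
  have hs' : Surjective (pullback.fst z.left (toCoskSucc n Y).left) := inferInstance
  obtain ⟨p, -⟩ := hs'.surj (IsLocalRing.closedPoint L)
  let q := (pullback z.left (toCoskSucc n Y).left).fromSpecResidueField p
  refine ⟨(pullback z.left (toCoskSucc n Y).left).residueField p, inferInstance,
    q ≫ pullback.fst _ _ ≫ t, Over.homMk (q ≫ pullback.fst _ _) (by simp), Over.homMk
      (q ≫ pullback.snd _ _) ?_, fun {Δ} hΔ θ => ?_⟩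
  · have h1 := Over.w (toCoskSucc n Y)
    have h2 := Over.w z
    dsimp at h1 h2 ⊢
    rw [← h1, Category.assoc, ← pullback.condition_assoc, h2]
  · rw [← toCoskSucc_proj Y hΔ, ← hz]
    refine (Category.assoc _ _ _).symm.trans (Eq.trans
      (congrArg (· ≫ coskSuccProj Y hΔ θ) ?_) (Category.assoc _ _ _))
    ext : 1
    simp [pullback.condition]

/-- In an étale hypercovering, every field-valued point of `X` lifts to `Y_0` after a field
extension. -/
lemma IsEtaleHypercovering.exists_lift {Y : SimplicialObject (Over X)}
    (hY : IsEtaleHypercovering Y) {L : Type u} [Field L] (t : Spec (CommRingCat.of L) ⟶ X) :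
    ∃ (L' : Type u) (_ : Field L') (t' : Spec (CommRingCat.of L') ⟶ X)
      (_ : Over.mk t' ⟶ Over.mk t), Nonempty (Over.mk t' ⟶ Y _⦋0⦌) := by
  have hs : Surjective (Y _⦋0⦌).hom := hY.zero.2
  have hs' : Surjective (pullback.fst t (Y _⦋0⦌).hom) := inferInstance
  obtain ⟨p, -⟩ := hs'.surj (IsLocalRing.closedPoint L)
  let q := (pullback t (Y _⦋0⦌).hom).fromSpecResidueField p
  exact ⟨(pullback t (Y _⦋0⦌).hom).residueField p, inferInstance,
    q ≫ pullback.fst _ _ ≫ t, Over.homMk (q ≫ pullback.fst _ _) (by simp), ⟨Over.homMk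
      (q ≫ pullback.snd _ _) (by simp [pullback.condition])⟩⟩

end Etale

/-! ### The simplicial scheme attached to a system of open subsets -/

section

variable {X : Scheme.{u}}

instance subsingleton_hom_open (T : Over X) (U : X.Opens) : Subsingleton (T ⟶ Over.mk U.ι) :=
  ⟨fun f g => by
    ext : 1
    rw [← cancel_mono U.ι]
    exact (Over.w f).trans (Over.w g).symm⟩

/-- The inclusion of open subschemes, as a morphism over `X`. -/
noncomputable def openMap {U V : X.Opens} (h : U ≤ V) : Over.mk U.ι ⟶ Over.mk V.ι :=
  Over.homMk (X.homOfLE h)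

/-- The point of the spectrum of a field. -/
noncomputable def specPoint (L : Type u) [Field L] : Spec (CommRingCat.of L) :=
  IsLocalRing.closedPoint L

lemma eq_specPoint {L : Type u} [Field L] (y : Spec (CommRingCat.of L)) : y = specPoint L :=
  Subsingleton.elim (α := PrimeSpectrum L) _ _

/-- A field-valued point of `X` with image in `U`, as a point of `U`. -/
noncomputable def openPoint {L : Type u} [Field L] (t : Spec (CommRingCat.of L) ⟶ X)
    {U : X.Opens} (h : t (specPoint L) ∈ U) : Over.mk t ⟶ Over.mk U.ι :=
  Over.homMk (IsOpenImmersion.lift U.ι t (by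
    rintro _ ⟨y, rfl⟩
    rw [eq_specPoint y]
    simpa using h)) (IsOpenImmersion.lift_fac _ _ _)

lemma mem_of_openPoint {L : Type u} [Field L] {t : Spec (CommRingCat.of L) ⟶ X}
    {U : X.Opens} (z : Over.mk t ⟶ Over.mk U.ι) : t (specPoint L) ∈ U := by
  have h : z.left ≫ U.ι = t := Over.w z
  rw [← h]
  exact (z.left (specPoint L)).2

/-- The disjoint union of a family of open subschemes of `X`, as a scheme over `X`. -/
noncomputable def disjointUnion {I : Type u} (U : I → X.Opens) : Over X :=
  Over.mk (Sigma.desc fun i => (U i).ι)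

section DisjointUnion

variable {I : Type u} (U : I → X.Opens)

/-- The inclusion of a summand in a disjoint union of open subschemes. -/
noncomputable def sumIncl (i : I) : Over.mk (U i).ι ⟶ disjointUnion U :=
  Over.homMk (Sigma.ι (fun i => (U i).toScheme) i) (Sigma.ι_desc _ _)

variable {U}

lemma disjointUnion_hom_ext {T : Over X} {f g : disjointUnion U ⟶ T}
    (h : ∀ i, sumIncl U i ≫ f = sumIncl U i ≫ g) : f = g := by
  ext : 1
  exact Sigma.hom_ext _ _ fun i => congrArg CommaMorphism.left (h i)

/-- The morphism out of a disjoint union given on the summands. -/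
noncomputable def sumDesc {T : Over X} (f : ∀ i, Over.mk (U i).ι ⟶ T) : disjointUnion U ⟶ T :=
  Over.homMk (Sigma.desc fun i => (f i).left) (Sigma.hom_ext _ _ fun i => by
    refine (Category.assoc _ _ _).symm.trans ((congrArg (· ≫ T.hom)
      (Sigma.ι_desc (fun i => (f i).left) i)).trans ?_)
    exact (Over.w (f i)).trans (Sigma.ι_desc (fun i => (U i).ι) i).symm)

@[simp]
lemma sumIncl_sumDesc {T : Over X} (f : ∀ i, Over.mk (U i).ι ⟶ T) (i : I) :
    sumIncl U i ≫ sumDesc f = f i := by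
  ext : 1
  exact Sigma.ι_desc _ _

instance isOpenImmersion_sumIncl_left (i : I) : IsOpenImmersion (sumIncl U i).left :=
  inferInstanceAs (IsOpenImmersion (Sigma.ι (fun i => (U i).toScheme) i))

lemma exists_sumIncl_left_eq (y : (disjointUnion U).left) :
    ∃ (i : I) (x : U i), (sumIncl U i).left x = y := by
  obtain ⟨⟨i, x⟩, rfl⟩ := (sigmaMk (fun i => (U i).toScheme)).surjective y
  exact ⟨i, x, (sigmaMk_mk (fun i => (U i).toScheme) i x).symm⟩

lemma eq_of_sumIncl_left_eq {i j : I} {x : U i} {y : U j}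
    (h : (sumIncl U i).left x = (sumIncl U j).left y) : i = j :=
  ((sigmaι_eq_iff (fun i => (U i).toScheme) i j x y).1 h |> Sigma.mk.inj).1

lemma comp_sumIncl_congr {T : Over X} {i j : I} (h : i = j)
    (f : T ⟶ Over.mk (U i).ι) (g : T ⟶ Over.mk (U j).ι) :
    f ≫ sumIncl U i = g ≫ sumIncl U j := by
  subst h
  rw [Subsingleton.elim f g]

lemma etale_disjointUnion : Etale (disjointUnion U).hom := by
  change Etale (Sigma.desc fun i => (U i).ι)
  have : IsZariskiLocalAtSource @Etale.{u} :=
    HasRingHomProperty.instIsZariskiLocalAtSource (Q := RingHom.Etale)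
  rw [IsZariskiLocalAtSource.iff_of_openCover (P := @Etale)
    (sigmaOpenCover (fun i => (U i).toScheme))]
  intro i
  have : (sigmaOpenCover (fun i => (U i).toScheme)).f i ≫
      (Sigma.desc fun i => (U i).ι) = (U i).ι := Sigma.ι_desc _ _
  rw [this]
  exact (inferInstance : Etale (U i).ι)

end DisjointUnion

namespace OpenSystem

variable (F : OpenSystem X)

/-- The open subscheme attached to a simplex. -/
abbrev opens {Δ : SimplexCategoryᵒᵖ} (σ : F.K.obj Δ) : X.Opens := F.U σ

/-- The disjoint union of the open subsets attached to the simplices of a given dimension. -/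
noncomputable abbrev level (Δ : SimplexCategoryᵒᵖ) : Over X :=
  disjointUnion fun σ : F.K.obj Δ => F.opens σ

/-- The inclusion of the summand attached to a simplex. -/
noncomputable abbrev incl {Δ : SimplexCategoryᵒᵖ} (σ : F.K.obj Δ) :
    Over.mk (F.opens σ).ι ⟶ F.level Δ :=
  sumIncl (fun σ : F.K.obj Δ => F.opens σ) σ

/-- The inclusion into the disjoint union of an open subset contained in one of the summands. -/
noncomputable def openTo {U : X.Opens} {Δ : SimplexCategoryᵒᵖ} (σ : F.K.obj Δ)
    (h : U ≤ F.opens σ) : Over.mk U.ι ⟶ F.level Δ :=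
  openMap h ≫ F.incl σ

lemma openTo_congr {U : X.Opens} {Δ : SimplexCategoryᵒᵖ} {σ τ : F.K.obj Δ} (e : σ = τ)
    (h : U ≤ F.opens σ) (h' : U ≤ F.opens τ) : F.openTo σ h = F.openTo τ h' :=
  comp_sumIncl_congr e _ _

lemma openTo_self {Δ : SimplexCategoryᵒᵖ} (σ : F.K.obj Δ) : F.openTo σ le_rfl = F.incl σ :=
  (comp_sumIncl_congr rfl _ (𝟙 _)).trans (Category.id_comp _)

variable {F} in
lemma openTo_sumDesc {Δ : SimplexCategoryᵒᵖ} {T : Over X}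
    (f : ∀ σ : F.K.obj Δ, Over.mk (F.opens σ).ι ⟶ T) {U : X.Opens} (σ : F.K.obj Δ)
    (h : U ≤ F.opens σ) : F.openTo σ h ≫ sumDesc f = openMap h ≫ f σ := by
  rw [openTo, Category.assoc, sumIncl_sumDesc]

lemma comp_openTo {U V : X.Opens} {Δ : SimplexCategoryᵒᵖ} (σ : F.K.obj Δ)
    (h : V ≤ F.opens σ) (h' : U ≤ V) :
    openMap h' ≫ F.openTo σ h = F.openTo σ (h'.trans h) := by
  rw [openTo, ← Category.assoc]
  exact comp_sumIncl_congr rfl _ _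

/-- The map between levels induced by a simplicial operator. -/
noncomputable def levelOp {Δ Δ' : SimplexCategoryᵒᵖ} (θ : Δ ⟶ Δ') : F.level Δ ⟶ F.level Δ' :=
  sumDesc fun σ => F.openTo (F.K.map θ σ) (F.le θ σ)

lemma openTo_levelOp {Δ Δ' : SimplexCategoryᵒᵖ} (θ : Δ ⟶ Δ') {U : X.Opens} (σ : F.K.obj Δ)
    (h : U ≤ F.opens σ) :
    F.openTo σ h ≫ F.levelOp θ = F.openTo (F.K.map θ σ) (h.trans (F.le θ σ)) := by
  rw [levelOp, openTo_sumDesc, comp_openTo]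

lemma incl_levelOp {Δ Δ' : SimplexCategoryᵒᵖ} (θ : Δ ⟶ Δ') (σ : F.K.obj Δ) :
    F.incl σ ≫ F.levelOp θ = F.openTo (F.K.map θ σ) (F.le θ σ) := by
  rw [levelOp, sumIncl_sumDesc]

/-- The simplicial scheme over `X` attached to a system of open subsets. -/
noncomputable def realization : SimplicialObject (Over X) where
  obj Δ := F.level Δ
  map θ := F.levelOp θ
  map_id Δ := disjointUnion_hom_ext fun σ => by
    rw [incl_levelOp, Category.comp_id]
    exact (F.openTo_congr (by simp) _ le_rfl).trans (F.openTo_self σ)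
  map_comp θ ψ := disjointUnion_hom_ext fun σ => by
    rw [incl_levelOp, ← Category.assoc, incl_levelOp, openTo_levelOp]
    exact F.openTo_congr (by simp) _ _

variable {F} in
/-- The map between levels induced by a morphism of systems of open subsets. -/
noncomputable def Hom.levelMap {G : OpenSystem X} (g : F.Hom G) (Δ : SimplexCategoryᵒᵖ) :
    F.level Δ ⟶ G.level Δ :=
  sumDesc fun σ => G.openTo (g.φ.app Δ σ) (g.le σ)

variable {F} in
lemma Hom.openTo_levelMap {G : OpenSystem X} (g : F.Hom G) {Δ : SimplexCategoryᵒᵖ}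
    {U : X.Opens} (σ : F.K.obj Δ) (h : U ≤ F.opens σ) :
    F.openTo σ h ≫ g.levelMap Δ = G.openTo (g.φ.app Δ σ) (h.trans (g.le σ)) := by
  rw [levelMap, openTo_sumDesc, comp_openTo]

variable {F} in
lemma Hom.incl_levelMap {G : OpenSystem X} (g : F.Hom G) {Δ : SimplexCategoryᵒᵖ}
    (σ : F.K.obj Δ) : F.incl σ ≫ g.levelMap Δ = G.openTo (g.φ.app Δ σ) (g.le σ) := by
  rw [levelMap, sumIncl_sumDesc]

variable {F} in
lemma Hom.levelMap_naturality {G : OpenSystem X} (g : F.Hom G) {Δ Δ' : SimplexCategoryᵒᵖ}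
    (θ : Δ ⟶ Δ') : F.levelOp θ ≫ g.levelMap Δ' = g.levelMap Δ ≫ G.levelOp θ :=
  disjointUnion_hom_ext fun σ => by
    rw [← Category.assoc, ← Category.assoc, incl_levelOp, Hom.openTo_levelMap, Hom.incl_levelMap,
      openTo_levelOp]
    have h : g.φ.app Δ' (F.K.map θ σ) = G.K.map θ (g.φ.app Δ σ) :=
      NatTrans.naturality_apply g.φ θ σ
    apply G.openTo_congr h

variable {F} in
/-- The morphism of simplicial schemes attached to a morphism of systems of open subsets. -/
noncomputable def Hom.realization {G : OpenSystem X} (g : F.Hom G) :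
    F.realization ⟶ G.realization where
  app Δ := g.levelMap Δ
  naturality _ _ θ := g.levelMap_naturality θ

/-- The points of the realization with values in a field `L` which lie over a given
`L`-valued point of `X` are the simplices whose open subset contains the image of this point. -/
noncomputable def stalkToPoints {L : Type u} [Field L] (t : Spec (CommRingCat.of L) ⟶ X) :
    F.stalk (t (specPoint L)) ⟶ points (Over.mk t) F.realization where
  app Δ := ↾fun σ => openPoint t σ.2 ≫ F.incl σ.1
  naturality Δ Δ' θ := ConcreteCategory.hom_ext _ _ fun σ => by
    refine Eq.trans ?_ (Category.assoc (openPoint t σ.2) (F.incl σ.1) _).symm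
    refine Eq.trans ?_ (congrArg (openPoint t σ.2 ≫ ·) (F.incl_levelOp θ σ.1).symm)
    refine Eq.trans ?_ (Category.assoc (openPoint t σ.2) (openMap _) (F.incl _))
    exact comp_sumIncl_congr rfl _ _

instance isIso_stalkToPoints {L : Type u} [Field L] (t : Spec (CommRingCat.of L) ⟶ X) :
    IsIso (F.stalkToPoints t) := by
  rw [NatTrans.isIso_iff_isIso_app]
  intro Δ
  rw [isIso_iff_bijective]
  constructor
  · intro σ τ h
    change openPoint t σ.2 ≫ F.incl σ.1 = openPoint t τ.2 ≫ F.incl τ.1 at h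
    have h1 := congrArg (fun f => f.left (specPoint L)) h
    simp only [Over.comp_left, Scheme.Hom.comp_apply] at h1
    exact Subtype.ext (eq_of_sumIncl_left_eq h1)
  · intro z
    change Over.mk t ⟶ F.level Δ at z
    obtain ⟨σ, x, hx⟩ := exists_sumIncl_left_eq (z.left (specPoint L))
    let w : Over.mk t ⟶ Over.mk (F.opens σ).ι := Over.homMk
      (IsOpenImmersion.lift (F.incl σ).left z.left (by
        rintro _ ⟨y, rfl⟩
        exact ⟨x, hx.trans (congrArg z.left (eq_specPoint y).symm)⟩)) (by
        refine (congrArg (_ ≫ ·) (Over.w (F.incl σ)).symm).trans ?_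
        refine (Category.assoc _ _ _).symm.trans ((congrArg (· ≫ _)
          (IsOpenImmersion.lift_fac _ _ _)).trans (Over.w z)))
    refine ⟨⟨σ, mem_of_openPoint w⟩, ?_⟩
    change openPoint t _ ≫ F.incl σ = z
    rw [Subsingleton.elim (openPoint t _) w]
    ext : 1
    exact IsOpenImmersion.lift_fac _ _ _

lemma isTrivialFibration_points (hF : F.IsHypercovering) {L : Type u} [Field L]
    (t : Spec (CommRingCat.of L) ⟶ X) :
    IsTrivialFibration (toPoint (points (Over.mk t) F.realization)) :=
  (IsTrivialFibration.of_isIso (inv (F.stalkToPoints t))).comp (hF _)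

variable {F} in
lemma Hom.IsLocalTrivialFibration.points {G : OpenSystem X} {g : F.Hom G}
    (hg : g.IsLocalTrivialFibration) {L : Type u} [Field L]
    (t : Spec (CommRingCat.of L) ⟶ X) :
    IsTrivialFibration (Functor.whiskerRight g.realization (coyoneda.obj (op (Over.mk t)))) := by
  have h : Functor.whiskerRight g.realization (coyoneda.obj (op (Over.mk t))) =
      inv (F.stalkToPoints t) ≫ g.stalkMap _ ≫ G.stalkToPoints t := by
    rw [IsIso.eq_inv_comp]
    ext Δ σ
    refine (Category.assoc (openPoint t σ.2) (F.incl σ.1) _).trans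
      ((congrArg (openPoint t σ.2 ≫ ·) (g.incl_levelMap σ.1)).trans ?_)
    refine (Category.assoc (openPoint t σ.2) (openMap _) (G.incl _)).symm.trans ?_
    exact comp_sumIncl_congr rfl _ _
  rw [h]
  exact (IsTrivialFibration.of_isIso _).comp ((hg _).comp (IsTrivialFibration.of_isIso _))

lemma etale_realization (Δ : SimplexCategoryᵒᵖ) : Etale (F.realization.obj Δ).hom :=
  etale_disjointUnion

end OpenSystem
end

/-! ### Special hypercoverings from systems of open subsets -/

section

variable {X : Scheme.{u}} {I : Type u} (U : I → X.Opens)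

open scoped Function in
/-- A finite disjoint union of open subschemes is separated over `X`: it is an open subscheme of a
finite disjoint union of copies of `X`, which is affine over `X`. -/
lemma isSeparated_disjointUnion [Finite I] : IsSeparated (disjointUnion U).hom := by
  let q : (∐ fun _ : I => X) ⟶ X := Sigma.desc fun _ => 𝟙 X
  have hq (i : I) : Sigma.ι (fun _ : I => X) i ≫ q = 𝟙 X := Sigma.ι_desc _ _
  have hq' (i : I) (x : X) : q (Sigma.ι (fun _ : I => X) i x) = x := by
    rw [← Scheme.Hom.comp_apply, hq]
    rfl
  have hα (V : I → X.Opens) :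
      IsOpenImmersion (Sigma.desc fun i => (V i).ι ≫ Sigma.ι (fun _ : I => X) i) := by
    refine isOpenImmersion_sigmaDesc _ _ fun i j hij => ?_
    refine Set.disjoint_left.2 ?_
    rintro _ ⟨x, rfl⟩ ⟨y, hy⟩
    rw [Scheme.Hom.comp_apply, Scheme.Hom.comp_apply] at hy
    exact hij ((Sigma.mk.inj ((sigmaι_eq_iff (fun _ : I => X) j i _ _).1 hy)).1).symm
  have hι (V : I → X.Opens) (i : I) (y : (V i).toScheme) :
      (Sigma.desc fun i => (V i).ι ≫ Sigma.ι (fun _ : I => X) i)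
        (Sigma.ι (fun i => (V i).toScheme) i y) = Sigma.ι (fun _ : I => X) i ((V i).ι y) :=
    congrArg (fun f : (V i).toScheme ⟶ ∐ fun _ : I => X => f y)
      (Sigma.ι_desc (fun i => (V i).ι ≫ Sigma.ι (fun _ : I => X) i) i)
  -- The preimage of an affine open subset `W` under the folding map is a finite disjoint union of
  -- copies of `W`.
  have : IsAffineHom q := by
    refine ⟨fun W hW => ?_⟩
    have : IsAffine W.toScheme := hW
    have := hα fun _ => W
    convert! isAffineOpen_opensRange (Sigma.desc fun i => W.ι ≫ Sigma.ι (fun _ : I => X) i)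
    ext x
    constructor
    · intro hx
      obtain ⟨⟨i, y⟩, rfl⟩ := (sigmaMk (fun _ : I => X)).surjective x
      rw [sigmaMk_mk] at hx ⊢
      change q _ ∈ W at hx
      rw [hq'] at hx
      exact ⟨_, hι (fun _ => W) i ⟨y, hx⟩⟩
    · rintro ⟨y, rfl⟩
      obtain ⟨⟨i, y⟩, rfl⟩ := (sigmaMk (fun _ : I => W.toScheme)).surjective y
      rw [sigmaMk_mk]
      change q _ ∈ W
      have : q _ = W.ι y := (congrArg q (hι (fun _ => W) i y)).trans (hq' _ _)
      rw [this]
      exact y.2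
  have := hα U
  have h : (Sigma.desc fun i => (U i).ι ≫ Sigma.ι (fun _ : I => X) i) ≫ q =
      Sigma.desc fun i => (U i).ι := by
    refine Sigma.hom_ext _ _ fun i => ?_
    rw [Sigma.ι_desc, ← Category.assoc, Sigma.ι_desc, Category.assoc, hq, Category.comp_id]
  change IsSeparated (Sigma.desc fun i => (U i).ι)
  rw [← h]
  have : IsSeparated q := inferInstance
  exact MorphismProperty.comp_mem @IsSeparated _ _ inferInstance this

lemma isNoetherian_disjointUnion [Finite I] [IsNoetherian X] :
    IsNoetherian (disjointUnion U).left := by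
  have (i : I) : CompactSpace (U i).toScheme :=
    inferInstanceAs (CompactSpace (U i : Set X))
  have : Etale (disjointUnion U).hom := etale_disjointUnion
  have : CompactSpace (disjointUnion U).left :=
    (sigmaMk (fun i => (U i).toScheme)).compactSpace
  exact { __ := LocallyOfFiniteType.isLocallyNoetherian (disjointUnion U).hom }

lemma quasiCompact_disjointUnion [Finite I] [IsNoetherian X] :
    QuasiCompact (disjointUnion U).hom := by
  have := isNoetherian_disjointUnion U
  infer_instance

/-- Replacing the index set of a disjoint union by a finite ordinal. -/
noncomputable def disjointUnionIso {r : ℕ} (e : Fin r ≃ I) :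
    Over.mk (Sigma.desc fun i => (U (e i)).ι) ≅ disjointUnion U :=
  Over.isoMk (Sigma.reindex e fun i => (U i).toScheme) (by
    refine Sigma.hom_ext _ _ fun i => ?_
    refine Eq.trans ?_ (Sigma.ι_desc (fun i => (U (e i)).ι) i).symm
    refine (Category.assoc _ _ _).symm.trans ((congrArg (· ≫ (disjointUnion U).hom)
      (Sigma.ι_reindex_hom e (fun i => (U i).toScheme) i)).trans ?_)
    exact Sigma.ι_desc (fun i => (U i).ι) (e i))

lemma isDisjointUnionOfStandardSmoothCovering_disjointUnion {k : Type u} [Field k]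
    {s : X ⟶ Spec (CommRingCat.of k)} [Finite I]
    (hU : ∀ i, IsAffineStandardSmooth ((U i).ι ≫ s)) (hcov : ∀ x, ∃ i, x ∈ U i) :
    IsDisjointUnionOfStandardSmoothCovering s (disjointUnion U) := by
  obtain ⟨r, ⟨e⟩⟩ := Finite.exists_equiv_fin I
  refine ⟨r, fun i => U (e.symm i), fun i => hU _, ?_, ⟨(disjointUnionIso U e.symm).symm⟩⟩
  refine top_le_iff.1 fun x _ => ?_
  obtain ⟨i, hi⟩ := hcov x
  exact TopologicalSpace.Opens.mem_iSup.2 ⟨e i, by simpa using hi⟩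

lemma IsDisjointUnionOfStandardSmoothCovering.exists_iso {k : Type u} [Field k]
    {s : X ⟶ Spec (CommRingCat.of k)} {T : Over X}
    (hT : IsDisjointUnionOfStandardSmoothCovering s T) :
    ∃ (I : Type u) (U : I → X.Opens), Nonempty (T ≅ disjointUnion U) := by
  obtain ⟨r, U, -, -, ⟨e⟩⟩ := hT
  let V (i : ULift (Fin r)) : X.Opens := U i.down
  exact ⟨ULift (Fin r), V, ⟨e ≪≫ disjointUnionIso V Equiv.ulift.symm⟩⟩

end

namespace OpenSystem

variable {X : Scheme.{u}} (F : OpenSystem X)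

/-- The disjoint union of the open subsets attached to the nondegenerate simplices. -/
noncomputable def nondegenerateLevel (n : ℕ) : Over X :=
  disjointUnion fun σ : F.K.nonDegenerate n => F.opens σ.1

/-- The inclusion of the part of a level which belongs to the nondegenerate simplices. -/
noncomputable def nondegenerateIncl (n : ℕ) :
    F.nondegenerateLevel n ⟶ F.realization _⦋n⦌ :=
  sumDesc fun σ => F.incl σ.1

lemma mono_nondegenerateIncl (n : ℕ) : Mono (F.nondegenerateIncl n) := by
  have : IsOpenImmersion (F.nondegenerateIncl n).left := by
    have (σ : F.K.nonDegenerate n) : IsOpenImmersion (F.incl σ.1).left :=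
      isOpenImmersion_sumIncl_left _
    refine isOpenImmersion_sigmaDesc _ (fun σ : F.K.nonDegenerate n => (F.incl σ.1).left)
      fun σ τ h => Set.disjoint_left.2 ?_
    rintro _ ⟨x, rfl⟩ ⟨y, hy⟩
    exact h (Subtype.ext (eq_of_sumIncl_left_eq hy).symm)
  exact Over.mono_of_mono_left _

lemma opens_le_of_epi {m n : ℕ} (e : ⦋n⦌ ⟶ ⦋m⦌) [Epi e] (σ : F.K _⦋m⦌) :
    F.opens (F.K.map e.op σ) ≤ F.opens σ :=
  have := isSplitEpi_of_epi e
  (F.U_map_of_isSplitEpi e σ).le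

/-- A simplex together with its presentation as a degeneracy of a nondegenerate simplex. -/
structure Presentation {n : ℕ} (σ : F.K _⦋n⦌) where
  /-- the dimension of the nondegenerate simplex -/
  m : ℕ
  /-- the degeneracy operator -/
  e : ⦋n⦌ ⟶ ⦋m⦌
  epi : Epi e
  /-- the nondegenerate simplex -/
  y : F.K.nonDegenerate m
  eq : σ = F.K.map e.op y.1

instance {n : ℕ} (σ : F.K _⦋n⦌) : Subsingleton (F.Presentation σ) where
  allEq := by
    rintro ⟨m, e, _, y, h⟩ ⟨m', e', _, y', h'⟩
    obtain rfl := F.K.unique_nonDegenerate_dim σ e y h e' y' h'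
    obtain rfl := F.K.unique_nonDegenerate_map σ e y h e' y' h'
    obtain rfl := F.K.unique_nonDegenerate_simplex σ e y h e y' h'
    rfl

lemma nonempty_presentation {n : ℕ} (σ : F.K _⦋n⦌) : Nonempty (F.Presentation σ) := by
  obtain ⟨m, e, he, y, h⟩ := F.K.exists_nonDegenerate σ
  exact ⟨⟨m, e, he, y, h⟩⟩

lemma incl_nondegenerateIncl_map {m n : ℕ} (e : ⦋n⦌ ⟶ ⦋m⦌) (y : F.K.nonDegenerate m) :
    sumIncl (fun σ : F.K.nonDegenerate m => F.opens σ.1) y ≫ F.nondegenerateIncl m ≫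
      F.realization.map e.op = F.openTo (F.K.map e.op y.1) (F.le e.op y.1) := by
  refine (Category.assoc _ _ _).symm.trans ?_
  refine (congrArg (· ≫ F.realization.map e.op) (sumIncl_sumDesc _ y)).trans ?_
  exact F.incl_levelOp e.op y.1

variable {F} in
/-- The map out of the summand of a simplex which is given by a family of maps out of the
nondegenerate parts of the levels. -/
noncomputable def Presentation.desc {n : ℕ} {T : Over X}
    (t : ∀ A : SimplicialObject.Splitting.IndexSet (op ⦋n⦌),
      F.nondegenerateLevel A.1.unop.len ⟶ T) {σ : F.K _⦋n⦌} (p : F.Presentation σ) :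
    Over.mk (F.opens σ).ι ⟶ T :=
  have := p.epi
  openMap ((F.opens_le_of_epi p.e p.y.1).trans' (congrArg F.opens p.eq).le) ≫
    sumIncl (fun σ : F.K.nonDegenerate p.m => F.opens σ.1) p.y ≫ t (.mk p.e)

/-- The map out of a level which is given on the summands of the splitting. -/
noncomputable def levelDesc {n : ℕ} {T : Over X}
    (t : ∀ A : SimplicialObject.Splitting.IndexSet (op ⦋n⦌),
      F.nondegenerateLevel A.1.unop.len ⟶ T) :
    F.level (op ⦋n⦌) ⟶ T :=
  sumDesc fun σ => (F.nonempty_presentation σ).some.desc t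

lemma openTo_levelDesc {n : ℕ} {T : Over X}
    (t : ∀ A : SimplicialObject.Splitting.IndexSet (op ⦋n⦌),
      F.nondegenerateLevel A.1.unop.len ⟶ T) {m : ℕ} (e : ⦋n⦌ ⟶ ⦋m⦌) [Epi e]
    (y : F.K.nonDegenerate m) :
    F.openTo (F.K.map e.op y.1) (F.le e.op y.1) ≫ F.levelDesc t =
      sumIncl (fun σ : F.K.nonDegenerate m => F.opens σ.1) y ≫ t (.mk e) := by
  rw [levelDesc, openTo_sumDesc]
  rw [Subsingleton.elim (F.nonempty_presentation (F.K.map e.op y.1)).some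
    ⟨m, e, inferInstance, y, rfl⟩]
  refine (Category.assoc _ _ _).symm.trans ?_
  rw [Subsingleton.elim (openMap _ ≫ openMap _) (𝟙 (Over.mk (F.opens y.1).ι))]
  exact Category.id_comp _

/-- The splitting of the realization by the nondegenerate simplices. -/
noncomputable def splitting : SimplicialObject.Splitting F.realization where
  N n := F.nondegenerateLevel n
  ι n := F.nondegenerateIncl n
  isColimit' := fun ⟨⟨n⟩⟩ => Cofan.IsColimit.mk _
    (fun c => F.levelDesc fun A => c.inj A)
    (by
      rintro c ⟨⟨⟨m⟩⟩, e, he⟩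
      refine disjointUnion_hom_ext fun y => ?_
      refine (Category.assoc _ _ _).symm.trans ?_
      refine (congrArg (· ≫ _) (F.incl_nondegenerateIncl_map e y)).trans ?_
      exact F.openTo_levelDesc _ e y)
    (by
      intro c f hf
      refine disjointUnion_hom_ext fun σ => ?_
      obtain ⟨m, e, he, y, rfl⟩ := F.nonempty_presentation σ
      have h (g : F.level (op ⦋n⦌) ⟶ c.pt) :
          F.incl (F.K.map e.op y.1) ≫ g = openMap (F.opens_le_of_epi e y.1) ≫
            F.openTo (F.K.map e.op y.1) (F.le e.op y.1) ≫ g := by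
        rw [← Category.assoc, comp_openTo, openTo_self]
      refine (h f).trans (Eq.trans ?_ (h _).symm)
      refine congrArg (openMap _ ≫ ·) ?_
      refine Eq.trans ?_ (F.openTo_levelDesc _ e y).symm
      refine (congrArg (· ≫ f) (F.incl_nondegenerateIncl_map e y).symm).trans ?_
      exact (Category.assoc _ _ _).trans (congrArg (sumIncl _ y ≫ ·) (hf (.mk e))))

lemma isSplit_realization : IsSplit F.realization :=
  ⟨F.splitting, F.mono_nondegenerateIncl⟩

lemma isEtaleHypercovering_realization [IsNoetherian X] (hF : F.IsHypercovering)
    (hfin : ∀ Δ, Finite (F.K.obj Δ)) : IsEtaleHypercovering F.realization where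
  isSeparated n := have := hfin (op ⦋n⦌); isSeparated_disjointUnion _
  locallyOfFiniteType n := have := F.etale_realization (op ⦋n⦌); inferInstance
  quasiCompact n := have := hfin (op ⦋n⦌); quasiCompact_disjointUnion _
  zero := etaleSurjective_zero F.etale_realization
    fun _ _ t => F.isTrivialFibration_points hF t
  succ n := etaleSurjective_toCoskSucc F.etale_realization
    (fun _ _ t => F.isTrivialFibration_points hF t) n

/-- The realization of a hypercovering by finitely many affine standard smooth open subsets in
each degree is a special hypercovering. -/
lemma isSpecialHypercovering_realization {k : Type u} [Field k]
    {s : X ⟶ Spec (CommRingCat.of k)} [IsNoetherian X] (hF : F.IsHypercovering)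
    (hfin : ∀ Δ, Finite (F.K.obj Δ))
    (hs : ∀ (Δ : SimplexCategoryᵒᵖ) (σ : F.K.obj Δ), IsAffineStandardSmooth ((F.opens σ).ι ≫ s)) :
    IsSpecialHypercovering s F.realization where
  isEtaleHypercovering := F.isEtaleHypercovering_realization hF hfin
  isSplit := F.isSplit_realization
  level n := have := hfin (op ⦋n⦌)
    isDisjointUnionOfStandardSmoothCovering_disjointUnion _ (hs _)
      fun x => hF.exists_mem x _

end OpenSystem

/-! ### Refinements by affine standard smooth open subsets -/

section

variable {k : Type u} [Field k] {X : Scheme.{u}} (s : X ⟶ Spec (CommRingCat.of k))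

lemma isAffineStandardSmooth_of_appLE {V : X.Opens} (hV : IsAffineOpen V)
    (h : (s.appLE ⊤ V le_top).hom.IsStandardSmooth) : IsAffineStandardSmooth (V.ι ≫ s) := by
  refine ⟨hV, ?_⟩
  have h1 : (V.ι ≫ s).appTop = s.appLE ⊤ V le_top ≫ V.topIso.inv := by
    simp only [Scheme.Hom.appLE, Scheme.Opens.topIso, Scheme.Hom.comp_appTop,
      Scheme.Opens.ι_appTop]
    refine Eq.trans ?_ (Category.assoc _ _ _).symm
    exact congrArg (s.app ⊤ ≫ ·) (X.presheaf.map_comp _ (eqToHom (by simp)).op)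
  rw [h1]
  have h2 (A B C D : CommRingCat.{u}) (a : A ≅ B) (b : B ⟶ C) (c : C ≅ D)
      (hb : b.hom.IsStandardSmooth) : (a.hom ≫ b ≫ c.hom).hom.IsStandardSmooth :=
    RingHom.isStandardSmooth_respectsIso.2 (c.hom.hom.comp b.hom) a.commRingCatIsoToRingEquiv
      (RingHom.isStandardSmooth_respectsIso.1 b.hom c.commRingCatIsoToRingEquiv hb)
  exact h2 _ _ _ _ (Scheme.ΓSpecIso (CommRingCat.of k)).symm _ V.topIso.symm h

/-- The affine standard smooth open subsets of a smooth `k`-scheme form a basis of its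
topology. -/
lemma exists_isAffineStandardSmooth [Smooth s] (O : X.Opens) (x : X) (hx : x ∈ O) :
    ∃ W : X.Opens, x ∈ W ∧ W ≤ O ∧ IsAffineStandardSmooth (W.ι ≫ s) := by
  obtain ⟨U, hU, V, hV, hxV, e, hs⟩ := Smooth.exists_isStandardSmooth s x
  obtain rfl : U = ⊤ := top_le_iff.1 fun y _ => by
    rw [eq_specPoint y, ← eq_specPoint (s x)]
    exact e hxV
  obtain ⟨f, hf, hxf⟩ := hV.exists_basicOpen_le (V := O) ⟨x, hx⟩ hxV
  refine ⟨X.basicOpen f, hxf, hf, isAffineStandardSmooth_of_appLE s (hV.basicOpen f) ?_⟩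
  have h : s.appLE ⊤ (X.basicOpen f) le_top =
      s.appLE ⊤ V e ≫ X.presheaf.map (homOfLE (X.basicOpen_le f)).op := by
    rw [Scheme.Hom.appLE_map]
  rw [h]
  have := hV.isLocalization_basicOpen f
  have h' : (X.presheaf.map (homOfLE (X.basicOpen_le f)).op).hom.IsStandardSmooth :=
    RingHom.isStandardSmooth_holdsForLocalizationAway _ f
  exact h'.comp hs

lemma isNoetherian_of_smooth [Smooth s] [QuasiCompact s] : IsNoetherian X := by
  have : CompactSpace X := QuasiCompact.compactSpace_of_compactSpace s
  exact { __ := LocallyOfFiniteType.isLocallyNoetherian s }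

variable [IsNoetherian X] [Smooth s]

lemma exists_finite_standardSmooth_cover (O : X.Opens) :
    ∃ c : Set X.Opens, c.Finite ∧ (∀ W ∈ c, W ≤ O ∧ IsAffineStandardSmooth (W.ι ≫ s)) ∧
      ∀ x ∈ O, ∃ W ∈ c, x ∈ W := by
  choose W hxW hWO hW using fun x : O => exists_isAffineStandardSmooth s O x.1 x.2
  obtain ⟨t, ht⟩ := (TopologicalSpace.NoetherianSpace.isCompact (O : Set X)).elim_finite_subcover
    (fun x => (W x : Set X)) (fun x => (W x).isOpen)
    (fun x hx => Set.mem_iUnion.2 ⟨⟨x, hx⟩, hxW ⟨x, hx⟩⟩)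
  refine ⟨W '' t, t.finite_toSet.image W, ?_, fun x hx => ?_⟩
  · rintro _ ⟨x, -, rfl⟩
    exact ⟨hWO x, hW x⟩
  · obtain ⟨y, hy, hxy⟩ := Set.mem_iUnion₂.1 (ht hx)
    exact ⟨W y, ⟨y, hy, rfl⟩, hxy⟩

/-- A finite family of affine standard smooth open subsets can be enlarged so as to cover the
intersections of its members with each other and with given open subsets. -/
lemma exists_refining_family {J : Type u} [Finite J] (O : J → X.Opens) (A : Set X.Opens)
    (hA : A.Finite) (hA' : ∀ W ∈ A, IsAffineStandardSmooth (W.ι ≫ s)) :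
    ∃ B : Set X.Opens, A ⊆ B ∧ B.Finite ∧ (∀ W ∈ B, IsAffineStandardSmooth (W.ι ≫ s)) ∧
      ∀ t ⊆ A, ∀ (j : J) (x : X), (∀ W ∈ t, x ∈ W) → x ∈ O j →
        ∃ W ∈ B, x ∈ W ∧ (∀ W' ∈ t, W ≤ W') ∧ W ≤ O j := by
  choose c hc hc' hcov using exists_finite_standardSmooth_cover s
  have : Finite {t | t ⊆ A} := hA.finite_subsets
  let V (p : {t | t ⊆ A} × J) : X.Opens :=
    ⟨(⋂ W ∈ p.1.1, (W : Set X)) ∩ O p.2,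
      ((hA.subset p.1.2).isOpen_biInter fun W _ => W.isOpen).inter (O p.2).isOpen⟩
  refine ⟨A ∪ ⋃ p, c (V p), Set.subset_union_left,
    hA.union (Set.finite_iUnion fun p => hc _), ?_, fun t ht j x hx hxj => ?_⟩
  · rintro W (hW | hW)
    · exact hA' W hW
    · obtain ⟨p, hp⟩ := Set.mem_iUnion.1 hW
      exact (hc' _ W hp).2
  · obtain ⟨W, hW, hxW⟩ := hcov (V ⟨⟨t, ht⟩, j⟩) x ⟨Set.mem_iInter₂.2 hx, hxj⟩
    have hle := (hc' _ W hW).1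
    exact ⟨W, Or.inr (Set.mem_iUnion.2 ⟨_, hW⟩), hxW,
      fun W' hW' y hy => Set.mem_iInter₂.1 (hle hy).1 W' hW', fun y hy => (hle hy).2⟩

/-- Every system of open subsets with finitely many simplices in each degree is refined by one
which consists of affine standard smooth open subsets. -/
lemma OpenSystem.exists_standardSmooth_refinement (F : OpenSystem X)
    (hfin : ∀ Δ, Finite (F.K.obj Δ)) :
    ∃ (G : OpenSystem X) (g : G.Hom F), g.IsLocalTrivialFibration ∧
      (∀ Δ, Finite (G.K.obj Δ)) ∧
      ∀ (Δ : SimplexCategoryᵒᵖ) (σ : G.K.obj Δ), IsAffineStandardSmooth ((G.opens σ).ι ≫ s) := by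
  let T := {A : Set X.Opens // A.Finite ∧ ∀ W ∈ A, IsAffineStandardSmooth (W.ι ≫ s)}
  have h (n : ℕ) (A : T) : ∃ B : T, A.1 ⊆ B.1 ∧ ∀ t ⊆ A.1, ∀ (σ : F.K.obj (op ⦋n⦌)) (x : X),
      (∀ W ∈ t, x ∈ W) → x ∈ F.opens σ →
        ∃ W ∈ B.1, x ∈ W ∧ (∀ W' ∈ t, W ≤ W') ∧ W ≤ F.opens σ := by
    obtain ⟨B, h1, h2, h3, h4⟩ := exists_refining_family s
      (fun σ : F.K.obj (op ⦋n⦌) => F.opens σ) A.1 A.2.1 A.2.2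
    exact ⟨⟨B, h2, h3⟩, h1, h4⟩
  choose next hnext hnext' using h
  let P (n : ℕ) : T := Nat.rec ⟨∅, Set.finite_empty, by simp⟩ (fun n A => next n A) n
  have hP : Monotone fun n => (P n).1 := monotone_nat_of_le_succ fun n => hnext n (P n)
  exact ⟨F.refine _ hP, F.refineHom hP,
    F.isLocalTrivialFibration_refineHom hP fun n => hnext' n (P n),
    fun Δ => F.finite_refine hP (fun n => (P n).2.1) Δ,
    fun Δ σ => (P (Δ.unop.len + 1)).2.2 _ (F.refine_U_mem hP σ)⟩

end

/-! ### Special hypercoverings as realizations of systems of open subsets -/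

lemma discreteTopology_connectedComponents (α : Type*) [TopologicalSpace α]
    [TopologicalSpace.NoetherianSpace α] : DiscreteTopology (_root_.ConnectedComponents α) := by
  have : Finite (irreducibleComponents α) :=
    TopologicalSpace.NoetherianSpace.finite_irreducibleComponents
  have : Finite (_root_.ConnectedComponents α) := by
    refine Finite.of_injective (fun c => (⟨irreducibleComponent (Quotient.out c),
      irreducibleComponent_mem_irreducibleComponents _⟩ : irreducibleComponents α))
      fun c d h => ?_
    rw [← Quotient.out_eq c, ← Quotient.out_eq d]
    refine ConnectedComponents.coe_eq_coe'.2 (irreducibleComponent_subset_connectedComponent ?_)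
    exact (congrArg Subtype.val h).le mem_irreducibleComponent
  have : T1Space (_root_.ConnectedComponents α) :=
    ⟨ConnectedComponents.surjective_coe.forall.2 fun x =>
      ConnectedComponents.isQuotientMap_coe.isClosed_preimage.1 (by
        rw [connectedComponents_preimage_singleton]
        exact isClosed_connectedComponent)⟩
  infer_instance

lemma finite_connectedComponents (α : Type*) [TopologicalSpace α]
    [TopologicalSpace.NoetherianSpace α] : Finite (_root_.ConnectedComponents α) :=
  have := discreteTopology_connectedComponents α
  finite_of_compact_of_discrete

section

variable {X : Scheme.{u}}

/-- The connected components of the `X`-scheme `T` are open and are mapped to `X` by open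
immersions. -/
structure HasEmbeddedComponents (T : Over X) : Prop where
  discrete : DiscreteTopology (_root_.ConnectedComponents T.left)
  isOpenImmersion (c : _root_.ConnectedComponents T.left) (V : T.left.Opens)
    (hV : ∀ y, y ∈ V ↔ ConnectedComponents.mk y = c) : IsOpenImmersion (V.ι ≫ T.hom)

lemma isClopen_range_sumIncl_left {I : Type u} (U : I → X.Opens) (i : I) :
    IsClopen (Set.range (sumIncl U i).left) := by
  have h (j : I) : IsOpen (Set.range (sumIncl U j).left) :=
    (sumIncl U j).left.isOpenEmbedding.isOpen_range
  refine ⟨⟨?_⟩, h i⟩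
  convert isOpen_iUnion fun j : {j // j ≠ i} => h j.1
  ext z
  rw [Set.mem_compl_iff, Set.mem_iUnion]
  constructor
  · intro hz
    obtain ⟨j, w, rfl⟩ := exists_sumIncl_left_eq z
    exact ⟨⟨j, by rintro rfl; exact hz ⟨w, rfl⟩⟩, w, rfl⟩
  · rintro ⟨j, w, rfl⟩ ⟨w', h'⟩
    exact j.2 (eq_of_sumIncl_left_eq h').symm

lemma hasEmbeddedComponents_of_iso {I : Type u} {U : I → X.Opens} {T : Over X}
    (e : T ≅ disjointUnion U) [IsNoetherian T.left] : HasEmbeddedComponents T where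
  discrete := discreteTopology_connectedComponents _
  isOpenImmersion c V hV := by
    obtain ⟨y, rfl⟩ := ConnectedComponents.surjective_coe c
    let b : T.left ⟶ (disjointUnion U).left := e.hom.left
    have : IsIso b := inferInstanceAs (IsIso ((Over.forget X).map e.hom))
    obtain ⟨i, x, hx⟩ := exists_sumIncl_left_eq (b y)
    -- The component lies in one of the summands, which is open and closed.
    have hVi : Set.range (V.ι ≫ b) ⊆ Set.range (sumIncl U i).left := by
      rintro _ ⟨z, rfl⟩
      rw [Scheme.Hom.comp_apply]
      have hz : V.ι z ∈ connectedComponent y := ConnectedComponents.coe_eq_coe'.1 ((hV _).1 z.2)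
      exact ((isClopen_range_sumIncl_left U i).preimage b.continuous).connectedComponent_subset
        ⟨x, hx⟩ hz
    let a : V.toScheme ⟶ (U i).toScheme := IsOpenImmersion.lift (sumIncl U i).left (V.ι ≫ b) hVi
    have ha : a ≫ (sumIncl U i).left = V.ι ≫ b := IsOpenImmersion.lift_fac _ _ _
    have : IsOpenImmersion a := by
      have : IsOpenImmersion (a ≫ (sumIncl U i).left) := by
        rw [ha]
        infer_instance
      exact IsOpenImmersion.of_comp _ (sumIncl U i).left
    have h : V.ι ≫ T.hom = a ≫ (U i).ι := by
      have h1 : b ≫ (disjointUnion U).hom = T.hom := Over.w e.hom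
      have h2 : (sumIncl U i).left ≫ (disjointUnion U).hom = (U i).ι := Over.w (sumIncl U i)
      rw [← h1, ← h2]
      exact (Category.assoc _ _ _).symm.trans
        ((congrArg (· ≫ (disjointUnion U).hom) ha.symm).trans (Category.assoc _ _ _))
    rw [h]
    infer_instance

namespace HasEmbeddedComponents

variable {T : Over X} (hT : HasEmbeddedComponents T)

/-- A connected component as an open subset. -/
def component (c : _root_.ConnectedComponents T.left) : T.left.Opens :=
  ⟨ConnectedComponents.mk ⁻¹' {c},
    have := hT.discrete
    (isOpen_discrete {c}).preimage ConnectedComponents.continuous_coe⟩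

lemma mem_component {c : _root_.ConnectedComponents T.left} {y : T.left} :
    y ∈ hT.component c ↔ ConnectedComponents.mk y = c :=
  Iff.rfl

instance isOpenImmersion_component (c : _root_.ConnectedComponents T.left) :
    IsOpenImmersion ((hT.component c).ι ≫ T.hom) :=
  hT.isOpenImmersion c _ fun _ => hT.mem_component

/-- The image in `X` of a connected component. -/
noncomputable def image (c : _root_.ConnectedComponents T.left) : X.Opens :=
  ((hT.component c).ι ≫ T.hom).opensRange

lemma mem_image {c : _root_.ConnectedComponents T.left} {x : X} :
    x ∈ hT.image c ↔ ∃ y : T.left, ConnectedComponents.mk y = c ∧ T.hom y = x := by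
  constructor
  · rintro ⟨y, rfl⟩
    exact ⟨y.1, y.2, rfl⟩
  · rintro ⟨y, hy, rfl⟩
    exact ⟨⟨y, hy⟩, rfl⟩

/-- The isomorphism of a connected component with its image in `X`. -/
noncomputable def imageIso (c : _root_.ConnectedComponents T.left) :
    (hT.image c).toScheme ≅ (hT.component c).toScheme :=
  IsOpenImmersion.isoOfRangeEq (hT.image c).ι ((hT.component c).ι ≫ T.hom)
    (congrArg SetLike.coe (hT.image c).opensRange_ι)

/-- The section of the structure morphism of `T` over the image of a connected component. -/
noncomputable def sect (c : _root_.ConnectedComponents T.left) : Over.mk (hT.image c).ι ⟶ T :=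
  Over.homMk ((hT.imageIso c).hom ≫ (hT.component c).ι)
    ((Category.assoc _ _ _).trans (IsOpenImmersion.isoOfRangeEq_hom_fac _ _ _))

instance isOpenImmersion_sect_left (c : _root_.ConnectedComponents T.left) :
    IsOpenImmersion (hT.sect c).left :=
  inferInstanceAs (IsOpenImmersion ((hT.imageIso c).hom ≫ (hT.component c).ι))

lemma sect_left_mem (c : _root_.ConnectedComponents T.left) (x : hT.image c) :
    ConnectedComponents.mk ((hT.sect c).left x) = c :=
  ((hT.imageIso c).hom x).2

lemma comp_sect_left_mem {S : Over X} {c : _root_.ConnectedComponents T.left}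
    (f : S ⟶ Over.mk (hT.image c).ι) (x : S.left) :
    ConnectedComponents.mk ((f ≫ hT.sect c).left x) = c := by
  rw [Over.comp_left, Scheme.Hom.comp_apply]
  exact hT.sect_left_mem c _

lemma exists_sect_left_eq {c : _root_.ConnectedComponents T.left} {y : T.left}
    (hy : ConnectedComponents.mk y = c) : ∃ x : hT.image c, (hT.sect c).left x = y := by
  let z : (hT.component c).toScheme := ⟨y, hy⟩
  refine ⟨(hT.imageIso c).inv z, ?_⟩
  exact congrArg (fun f => (hT.component c).ι (f z)) (hT.imageIso c).inv_hom_id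

include hT in
/-- Morphisms into `T` over `X` which land in the same connected component are equal. -/
lemma hom_ext {S : Over X} {f g : S ⟶ T} (c : _root_.ConnectedComponents T.left)
    (hf : ∀ x, ConnectedComponents.mk (f.left x) = c)
    (hg : ∀ x, ConnectedComponents.mk (g.left x) = c) : f = g := by
  have h (f : S ⟶ T) (hf : ∀ x, ConnectedComponents.mk (f.left x) = c) :
      Set.range f.left ⊆ Set.range (hT.component c).ι := by
    rintro _ ⟨x, rfl⟩
    exact ⟨⟨_, hf x⟩, rfl⟩
  have hf' := IsOpenImmersion.lift_fac (hT.component c).ι f.left (h f hf)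
  have hg' := IsOpenImmersion.lift_fac (hT.component c).ι g.left (h g hg)
  ext : 1
  rw [← hf', ← hg']
  congr 1
  rw [← cancel_mono ((hT.component c).ι ≫ T.hom), ← Category.assoc, ← Category.assoc, hf', hg']
  exact (Over.w f).trans (Over.w g).symm

/-- The morphism to `T` from the disjoint union of the images of its connected components. -/
noncomputable def fromImages : disjointUnion hT.image ⟶ T :=
  sumDesc hT.sect

open scoped Function in
instance isIso_fromImages : IsIso hT.fromImages := by
  have h1 : IsOpenImmersion hT.fromImages.left := by
    refine isOpenImmersion_sigmaDesc _ (fun c => (hT.sect c).left) fun c d h =>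
      Set.disjoint_left.2 ?_
    rintro _ ⟨x, rfl⟩ ⟨y, hy⟩
    exact h ((hT.sect_left_mem c x).symm.trans
      ((congrArg ConnectedComponents.mk hy.symm).trans (hT.sect_left_mem d y)))
  have h2 : hT.fromImages.left.opensRange = ⊤ := by
    refine top_le_iff.1 fun y _ => ?_
    obtain ⟨x, hx⟩ := hT.exists_sect_left_eq (rfl : ConnectedComponents.mk y = _)
    refine ⟨(sumIncl hT.image _).left x, ?_⟩
    exact (congrArg (fun f => f.left x) (sumIncl_sumDesc hT.sect _)).trans hx
  have h3 : IsIso hT.fromImages.left := isIso_of_isOpenImmersion_of_opensRange_eq_top _ h2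
  have h4 : IsIso ((Over.forget X).map hT.fromImages) := h3
  exact isIso_of_reflects_iso _ (Over.forget X)

end HasEmbeddedComponents

/-- The simplicial set of connected components of a simplicial scheme over `X`. -/
def simplicialComponents (Y : SimplicialObject (Over X)) : SSet.{u} where
  obj Δ := _root_.ConnectedComponents (Y.obj Δ).left
  map θ := ↾(Y.map θ).left.continuous.connectedComponentsMap
  map_id Δ := ConcreteCategory.hom_ext _ _ <| ConnectedComponents.surjective_coe.forall.2
    fun y => congrArg (fun f => ConnectedComponents.mk (f.left y)) (Y.map_id Δ)
  map_comp θ ψ := ConcreteCategory.hom_ext _ _ <| ConnectedComponents.surjective_coe.forall.2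
    fun y => congrArg (fun f => ConnectedComponents.mk (f.left y)) (Y.map_comp θ ψ)

variable {Y : SimplicialObject (Over X)} (hY : ∀ Δ, HasEmbeddedComponents (Y.obj Δ))

/-- The system formed by the images in `X` of the connected components of a simplicial scheme. -/
noncomputable def componentSystem : OpenSystem X where
  K := simplicialComponents Y
  U {Δ} c := (hY Δ).image c
  le {Δ Δ'} θ c := by
    intro x hx
    obtain ⟨y, rfl, rfl⟩ := (hY Δ).mem_image.1 hx
    refine (hY Δ').mem_image.2 ⟨(Y.map θ).left y, rfl, ?_⟩
    rw [← Scheme.Hom.comp_apply]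
    exact congrArg (fun f => f y) (Over.w (Y.map θ))

lemma sect_map {Δ Δ' : SimplexCategoryᵒᵖ} (θ : Δ ⟶ Δ')
    (c : _root_.ConnectedComponents (Y.obj Δ).left) :
    (hY Δ).sect c ≫ Y.map θ = openMap ((componentSystem hY).le θ c) ≫
      (hY Δ').sect ((simplicialComponents Y).map θ c) := by
  refine (hY Δ').hom_ext ((simplicialComponents Y).map θ c) (fun x => ?_) fun x => ?_
  · have h1 : ((hY Δ).sect c ≫ Y.map θ).left x = (Y.map θ).left (((hY Δ).sect c).left x) := by
      rw [Over.comp_left, Scheme.Hom.comp_apply]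
    rw [h1]
    exact congrArg (Y.map θ).left.continuous.connectedComponentsMap ((hY Δ).sect_left_mem c x)
  · exact (hY Δ').comp_sect_left_mem _ _

lemma levelOp_fromImages {Δ Δ' : SimplexCategoryᵒᵖ} (θ : Δ ⟶ Δ') :
    (componentSystem hY).levelOp θ ≫ (hY Δ').fromImages = (hY Δ).fromImages ≫ Y.map θ :=
  disjointUnion_hom_ext fun c => by
    have h1 := OpenSystem.openTo_sumDesc (F := componentSystem hY) (hY Δ').sect
      ((simplicialComponents Y).map θ c) ((componentSystem hY).le θ c)
    refine (Category.assoc _ _ _).symm.trans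
      ((congrArg (· ≫ (hY Δ').fromImages) ((componentSystem hY).incl_levelOp θ c)).trans ?_)
    refine h1.trans ((sect_map hY θ c).symm.trans ?_)
    exact (congrArg (· ≫ Y.map θ) (sumIncl_sumDesc (hY Δ).sect c).symm).trans
      (Category.assoc _ _ _)

/-- A simplicial scheme over `X` whose levels have embedded components is the realization of
the system of images of its connected components. -/
noncomputable def componentSystemIso : (componentSystem hY).realization ≅ Y :=
  NatIso.ofComponents
    (fun Δ => @asIso _ _ _ _ (hY Δ).fromImages (hY Δ).isIso_fromImages)
    (fun θ => levelOp_fromImages hY θ)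

end

namespace OpenSystem

variable {X : Scheme.{u}} {F : OpenSystem X}

lemma eq_of_comp_incl_eq {L : Type u} [Field L] {t : Spec (CommRingCat.of L) ⟶ X}
    {Δ : SimplexCategoryᵒᵖ} {σ τ : F.K.obj Δ} {f : Over.mk t ⟶ Over.mk (F.opens σ).ι}
    {g : Over.mk t ⟶ Over.mk (F.opens τ).ι} (h : f ≫ F.incl σ = g ≫ F.incl τ) : σ = τ := by
  have h1 := congrArg (fun f => f.left (specPoint L)) h
  simp only [Over.comp_left, Scheme.Hom.comp_apply] at h1
  exact eq_of_sumIncl_left_eq h1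

lemma exists_openPoint_eq {L : Type u} [Field L] {t : Spec (CommRingCat.of L) ⟶ X}
    {Δ : SimplexCategoryᵒᵖ} (z : Over.mk t ⟶ F.realization.obj Δ) :
    ∃ (σ : F.K.obj Δ) (h : t (specPoint L) ∈ F.opens σ), openPoint t h ≫ F.incl σ = z := by
  have := (NatTrans.isIso_iff_isIso_app (F.stalkToPoints t)).1 inferInstance Δ
  obtain ⟨σ, hσ⟩ := ((isIso_iff_bijective _).1 this).surjective z
  exact ⟨σ.1, σ.2, hσ⟩

lemma apply_specPoint_eq {L L' : Type u} [Field L] [Field L'] {t : Spec (CommRingCat.of L) ⟶ X}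
    {t' : Spec (CommRingCat.of L') ⟶ X} (i : Over.mk t' ⟶ Over.mk t) :
    t' (specPoint L') = t (specPoint L) := by
  have h : i.left ≫ t = t' := Over.w i
  rw [← h, Scheme.Hom.comp_apply]
  exact congrArg t (eq_specPoint _)

lemma exists_specPoint_eq (x : X) :
    ∃ (L : Type u) (_ : Field L) (t : Spec (CommRingCat.of L) ⟶ X), t (specPoint L) = x :=
  ⟨X.residueField x, inferInstance, X.fromSpecResidueField x, X.fromSpecResidueField_apply x _⟩

/-- A system of open subsets is a hypercovering if its realization is an étale hypercovering:
field-valued points can be lifted after a field extension, which does not change the simplex to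
which they belong. -/
lemma isHypercovering_of_iso {Y : SimplicialObject (Over X)} (e : F.realization ≅ Y)
    (hY : IsEtaleHypercovering Y) : F.IsHypercovering := by
  intro x
  obtain ⟨L, _, t, rfl⟩ := exists_specPoint_eq x
  constructor
  · intro _
    obtain ⟨L', _, t', i, ⟨c⟩⟩ := hY.exists_lift t
    obtain ⟨σ, hσ, -⟩ := exists_openPoint_eq (c ≫ e.inv.app _)
    rw [apply_specPoint_eq i] at hσ
    exact ⟨⟨σ, hσ⟩, rfl⟩
  · intro n a _ _
    obtain ⟨L', _, t', i, c, hc⟩ := hY.exists_fill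
      ((a.map (F.stalkToPoints t)).map
        (Functor.whiskerRight e.hom (coyoneda.obj (op (Over.mk t)))))
    obtain ⟨σ, hσ, hσc⟩ := exists_openPoint_eq (c ≫ e.inv.app _)
    have hσ' := hσ
    rw [apply_specPoint_eq i] at hσ'
    refine ⟨⟨σ, hσ'⟩, fun {Δ} hΔ θ => Subtype.ext ?_, rfl⟩
    change F.K.map θ.op σ = (a.val hΔ θ).1
    have h1 : (openPoint t' hσ ≫ openMap (F.le θ.op σ)) ≫ F.incl (F.K.map θ.op σ) =
        (openPoint t' hσ ≫ F.incl σ) ≫ F.realization.map θ.op :=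
      (Category.assoc _ _ _).trans ((congrArg (openPoint t' hσ ≫ ·)
        (F.incl_levelOp θ.op σ).symm).trans (Category.assoc _ _ _).symm)
    have h2 : (c ≫ e.inv.app _) ≫ F.realization.map θ.op =
        (i ≫ openPoint t (a.val hΔ θ).2) ≫ F.incl (a.val hΔ θ).1 := by
      rw [Category.assoc, ← e.inv.naturality, ← Category.assoc, hc hΔ θ]
      change (i ≫ (openPoint t (a.val hΔ θ).2 ≫ F.incl (a.val hΔ θ).1) ≫ e.hom.app (op Δ)) ≫
        e.inv.app (op Δ) = _
      refine (Category.assoc _ _ _).trans ?_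
      refine Eq.trans ?_ (Category.assoc _ _ _).symm
      refine congrArg (i ≫ ·) ?_
      refine (Category.assoc _ _ _).trans ?_
      exact (congrArg (_ ≫ ·) (e.hom_inv_id_app (op Δ))).trans (Category.comp_id _)
    exact eq_of_comp_incl_eq (h1.trans ((congrArg (· ≫ F.realization.map θ.op) hσc).trans h2))

end OpenSystem

/-! ### Functoriality of realizations -/

section

variable {X X' : Scheme.{u}} (f : X ⟶ X')

/-- The restriction of `f` to open subschemes, as a morphism over `X'`. -/
noncomputable def openMapOver {U : X.Opens} {V : X'.Opens} (h : U ≤ f ⁻¹ᵁ V) :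
    (Over.map f).obj (Over.mk U.ι) ⟶ Over.mk V.ι :=
  Over.homMk (f.resLE V U h) (f.resLE_comp_ι h)

variable {f}

lemma map_disjointUnion_hom_ext {I : Type u} {U : I → X.Opens} {T : Over X'}
    {a b : (Over.map f).obj (disjointUnion U) ⟶ T}
    (h : ∀ i, (Over.map f).map (sumIncl U i) ≫ a = (Over.map f).map (sumIncl U i) ≫ b) :
    a = b := by
  ext : 1
  exact Sigma.hom_ext _ _ fun i => congrArg CommaMorphism.left (h i)

variable (f) in
/-- The morphism over `X'` out of a disjoint union of open subschemes of `X` which is given on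
the summands. -/
noncomputable def mapSumDesc {I : Type u} {U : I → X.Opens} {T : Over X'}
    (a : ∀ i, (Over.map f).obj (Over.mk (U i).ι) ⟶ T) :
    (Over.map f).obj (disjointUnion U) ⟶ T :=
  Over.homMk (Sigma.desc fun i => (a i).left) (Sigma.hom_ext _ _ fun i => by
    refine (Category.assoc _ _ _).symm.trans ((congrArg (· ≫ T.hom)
      (Sigma.ι_desc (fun i => (a i).left) i)).trans ?_)
    refine (Over.w (a i)).trans ?_
    refine (congrArg (· ≫ f) (Sigma.ι_desc (fun i => (U i).ι) i).symm).trans ?_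
    exact Category.assoc _ _ _)

lemma map_sumIncl_mapSumDesc {I : Type u} {U : I → X.Opens} {T : Over X'}
    (a : ∀ i, (Over.map f).obj (Over.mk (U i).ι) ⟶ T) (i : I) :
    (Over.map f).map (sumIncl U i) ≫ mapSumDesc f a = a i := by
  ext : 1
  exact Sigma.ι_desc _ _

namespace OpenSystem

variable {F : OpenSystem X} {G : OpenSystem X'}

/-- The map on levels induced by a morphism of systems of open subsets over `f`. -/
noncomputable def Hom.levelMapOver (g : F.Hom (G.comap f.base.hom)) (Δ : SimplexCategoryᵒᵖ) :
    (Over.map f).obj (F.level Δ) ⟶ G.level Δ :=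
  mapSumDesc f fun σ => openMapOver f (V := G.opens (g.φ.app Δ σ)) (g.le σ) ≫ G.incl _

lemma Hom.map_incl_levelMapOver (g : F.Hom (G.comap f.base.hom)) {Δ : SimplexCategoryᵒᵖ}
    (σ : F.K.obj Δ) : (Over.map f).map (F.incl σ) ≫ g.levelMapOver Δ =
      openMapOver f (V := G.opens (g.φ.app Δ σ)) (g.le σ) ≫ G.incl _ :=
  map_sumIncl_mapSumDesc _ σ

lemma Hom.levelMapOver_naturality (g : F.Hom (G.comap f.base.hom)) {Δ Δ' : SimplexCategoryᵒᵖ}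
    (θ : Δ ⟶ Δ') : (Over.map f).map (F.levelOp θ) ≫ g.levelMapOver Δ' =
      g.levelMapOver Δ ≫ G.levelOp θ :=
  map_disjointUnion_hom_ext fun σ => by
    have h : g.φ.app Δ' (F.K.map θ σ) = G.K.map θ (g.φ.app Δ σ) :=
      NatTrans.naturality_apply g.φ θ σ
    have h1 : (Over.map f).map (F.incl σ) ≫ (Over.map f).map (F.levelOp θ) ≫ g.levelMapOver Δ' =
        ((Over.map f).map (openMap (F.le θ σ)) ≫
          openMapOver f (V := G.opens (g.φ.app Δ' (F.K.map θ σ))) (g.le (F.K.map θ σ))) ≫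
            G.incl _ := by
      rw [← Category.assoc, ← Functor.map_comp, incl_levelOp, openTo, Functor.map_comp,
        Category.assoc, Category.assoc, g.map_incl_levelMapOver]
    have h2 : (Over.map f).map (F.incl σ) ≫ g.levelMapOver Δ ≫ G.levelOp θ =
        (openMapOver f (V := G.opens (g.φ.app Δ σ)) (g.le σ) ≫ openMap (G.le θ (g.φ.app Δ σ))) ≫
            G.incl _ := by
      rw [← Category.assoc, g.map_incl_levelMapOver, Category.assoc]
      exact (congrArg (_ ≫ ·) (G.incl_levelOp θ _)).trans (Category.assoc _ _ _).symm
    refine h1.trans (Eq.trans ?_ h2.symm)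
    exact comp_sumIncl_congr h _ _

/-- The morphism of simplicial schemes over `f` induced by a morphism of systems of open
subsets over `f`. -/
noncomputable def Hom.realizationOver (g : F.Hom (G.comap f.base.hom)) :
    pushforward f F.realization ⟶ G.realization where
  app Δ := g.levelMapOver Δ
  naturality _ _ θ := g.levelMapOver_naturality θ

end OpenSystem
end

/-! ### Existence, common refinements and functoriality -/

section

variable {k : Type u} [Field k]

lemma IsSpecialHypercovering.exists_openSystem {X : Scheme.{u}} [IsNoetherian X]
    {s : X ⟶ Spec (CommRingCat.of k)} {Y : SimplicialObject (Over X)}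
    (hY : IsSpecialHypercovering s Y) :
    ∃ F : OpenSystem X, F.IsHypercovering ∧ (∀ Δ, Finite (F.K.obj Δ)) ∧
      Nonempty (F.realization ≅ Y) := by
  have hN : ∀ Δ, IsNoetherian (Y.obj Δ).left := fun ⟨⟨n⟩⟩ => by
    have h1 := hY.isEtaleHypercovering.locallyOfFiniteType n
    have h2 := hY.isEtaleHypercovering.quasiCompact n
    have h3 := QuasiCompact.compactSpace_of_compactSpace (Y _⦋n⦌).hom
    exact { __ := LocallyOfFiniteType.isLocallyNoetherian (Y _⦋n⦌).hom, __ := h3 }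
  have hE : ∀ Δ, HasEmbeddedComponents (Y.obj Δ) := fun ⟨⟨n⟩⟩ => by
    obtain ⟨I, U, ⟨e⟩⟩ := (hY.level n).exists_iso
    have := hN (op ⦋n⦌)
    exact hasEmbeddedComponents_of_iso e
  exact ⟨componentSystem hE, OpenSystem.isHypercovering_of_iso (componentSystemIso hE)
    hY.isEtaleHypercovering, fun Δ => have := hN Δ; finite_connectedComponents (Y.obj Δ).left,
    ⟨componentSystemIso hE⟩⟩

namespace OpenSystem

variable {X : Scheme.{u}}

lemma Hom.IsLocalTrivialFibration.isRefinement {G F : OpenSystem X} {g : G.Hom F}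
    (hg : g.IsLocalTrivialFibration) {Y : SimplicialObject (Over X)} (e : F.realization ≅ Y)
    (hG : IsEtaleHypercovering G.realization) (hY : IsEtaleHypercovering Y) :
    IsRefinement (g.realization ≫ e.hom) := by
  refine isRefinement_of_points _ hG hY G.etale_realization (fun Δ => ?_) fun L _ t => ?_
  · have h : (e.inv.app Δ).left ≫ (F.realization.obj Δ).hom = (Y.obj Δ).hom :=
      Over.w (e.inv.app Δ)
    have : IsIso (e.inv.app Δ).left :=
      inferInstanceAs (IsIso ((Over.forget X).map (e.inv.app Δ)))
    have := F.etale_realization Δ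
    rw [← h]
    exact Etale.etale_comp _ _
  · rw [Functor.whiskerRight_comp]
    exact (hg.points t).comp (IsTrivialFibration.of_isIso _)

/-- A hypercovering system which is finite in each degree is refined by a special
hypercovering. -/
lemma IsHypercovering.exists_special {F : OpenSystem X} (hF : F.IsHypercovering)
    (hfin : ∀ Δ, Finite (F.K.obj Δ)) [IsNoetherian X] (s : X ⟶ Spec (CommRingCat.of k))
    [Smooth s] :
    ∃ (G : OpenSystem X) (g : G.Hom F), g.IsLocalTrivialFibration ∧ G.IsHypercovering ∧
      (∀ Δ, Finite (G.K.obj Δ)) ∧ IsSpecialHypercovering s G.realization := by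
  obtain ⟨G, g, hg, hfin', hs⟩ := F.exists_standardSmooth_refinement s hfin
  have hG := hg.isHypercovering hF
  exact ⟨G, g, hg, hG, hfin', G.isSpecialHypercovering_realization hG hfin' hs⟩

end OpenSystem

end

end SpecialHypercovering

open SpecialHypercovering
theorem mainTheorem4 (p : ℕ) [Fact p.Prime] (k : Type u) [Field k] [CharP k p] [PerfectField k] :
    -- existence
    (∀ (X : Scheme.{u}) (s : X ⟶ Spec (CommRingCat.of k)), Smooth s → QuasiCompact s →
      ∃ Y : SimplicialObject (Over X), IsSpecialHypercovering s Y) ∧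
    -- common refinements
    (∀ (X : Scheme.{u}) (s : X ⟶ Spec (CommRingCat.of k)), Smooth s → QuasiCompact s →
      ∀ Y Y' : SimplicialObject (Over X),
        IsSpecialHypercovering s Y → IsSpecialHypercovering s Y' →
        ∃ (Y'' : SimplicialObject (Over X)) (g : Y'' ⟶ Y) (g' : Y'' ⟶ Y'),
          IsSpecialHypercovering s Y'' ∧ IsRefinement g ∧ IsRefinement g') ∧
    -- functoriality
    (∀ (X X' : Scheme.{u}) (s : X ⟶ Spec (CommRingCat.of k)) (s' : X' ⟶ Spec (CommRingCat.of k)),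
      Smooth s → QuasiCompact s → Smooth s' → QuasiCompact s' →
      ∀ f : X ⟶ X', f ≫ s' = s →
        ∃ (Y : SimplicialObject (Over X)) (Y' : SimplicialObject (Over X')),
          IsSpecialHypercovering s Y ∧ IsSpecialHypercovering s' Y' ∧
          Nonempty (pushforward f Y ⟶ Y')) := by
  have hfin (X : Scheme.{u}) (Δ : SimplexCategoryᵒᵖ) :
      Finite ((OpenSystem.terminal X).K.obj Δ) :=
    inferInstanceAs (Finite PUnit)
  refine ⟨fun X s _ _ => ?_, fun X s _ _ Y Y' hY hY' => ?_,
    fun X X' s s' _ _ _ _ f _ => ?_⟩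
  · have := isNoetherian_of_smooth s
    obtain ⟨G, -, -, -, -, hG⟩ :=
      (OpenSystem.isHypercovering_terminal (X := X)).exists_special (hfin X) s
    exact ⟨_, hG⟩
  · have := isNoetherian_of_smooth s
    obtain ⟨F, hF, hFfin, ⟨e⟩⟩ := hY.exists_openSystem
    obtain ⟨F', hF', hFfin', ⟨e'⟩⟩ := hY'.exists_openSystem
    have h1 := OpenSystem.isLocalTrivialFibration_fst F hF'
    have h2 := OpenSystem.isLocalTrivialFibration_snd F' hF
    obtain ⟨G, g, hg, -, -, hG⟩ := (h1.isHypercovering hF).exists_special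
      (fun Δ => have := hFfin Δ; have := hFfin' Δ
        inferInstanceAs (Finite (F.K.obj Δ × F'.K.obj Δ))) s
    exact ⟨_, _, _, hG,
      (hg.comp h1).isRefinement e hG.isEtaleHypercovering hY.isEtaleHypercovering,
      (hg.comp h2).isRefinement e' hG.isEtaleHypercovering hY'.isEtaleHypercovering⟩
  · have := isNoetherian_of_smooth s
    have := isNoetherian_of_smooth s'
    obtain ⟨G', -, -, hG', hfin', hG's⟩ :=
      (OpenSystem.isHypercovering_terminal (X := X')).exists_special (hfin X') s'
    obtain ⟨G, g, -, -, -, hG⟩ := (hG'.comap f.base.hom).exists_special hfin' s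
    exact ⟨_, _, hG, hG's, ⟨g.realizationOver⟩⟩
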